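/- Let $P$ be a finite set of $n$ points in the Euclidean plane, no two of which lie on a line parallel to a direction at an angle that is a multiple of $\pi/3$ with the $x$-axis. Around every $u\in P$ the plane is divided into six cones by the rays from $u$ at the multiples of $\pi/3$. In counterclockwise order from the positive $x$-axis they are called $\overline C_1,C_0,\overline C_2,C_1,\overline C_0,C_2$; the cones $C_i$ are positive, and the opposite cones $\overline C_i$ are negative. In the half-$\theta_6$-graph on $P$ each $u\in P$ is joined, in each of its positive cones that contains a point of $P$, to the point whose projection on the bisector of the cone is closest to $u$. The subgraph $G_{12}$ has the same vertices; of the half-$\theta_6$-edges at a vertex $v$ to neighbours in a given negative cone of $v$ it keeps only the first and the last one in clockwise order around $v$ and the one to the neighbour whose projection on the bisector of the cone is closest to $v$ (every edge lies in a negative cone of exactly one of its endpoints). A deterministic $1$-local $m$-memory routing algorithm is a function that takes the current vertex $s$, the destination $t$, the set of vertices reachable from $s$ by at most one edge, and the contents of $m$ memory units carried with the message (all zero at the start), and returns the next vertex, to which the message is forwarded along an edge, and the new contents of the memory. At all times until the message arrives, each memory unit holds either one of the integers $0,\dots,n-1$ or the position of a vertex. Theorem. There are a constant $m$ and a single deterministic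 $1$-local $m$-memory routing algorithm, both independent of $P$, such that for every $P$ as above and all $u,w\in P$ with $w$ in a positive cone of $u$, routing on $G_{12}$: (i) the message from $u$ to $w$ arrives at $w$ after finitely many steps and travels a total distance of at most $38\,|uw|$; (ii) the message from $w$ to $u$ arrives at $u$ after finitely many steps and travels a total distance of at most $19\cdot\frac{5}{\sqrt3}\,|uw|$. That is, the routing ratio on $G_{12}$ is at most $38$ toward a vertex in a positive cone and at most $19\cdot 5/\sqrt3\approx 54.85$ toward a vertex in a negative cone. -/

import Mathlib

noncomputable section

/-- The Euclidean plane. -/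
abbrev Plane : Type := EuclideanSpace ℝ (Fin 2)

/-- The unit vector at angle `θ` from the positive `x`-axis. -/
def unitDir (θ : ℝ) : Plane := !₂[Real.cos θ, Real.sin θ]

/-- The `k`-th of the six (closed) cones with apex `u`, in counterclockwise order: the region between
the rays from `u` at angles `k * π / 3` and `(k + 1) * π / 3`, without the apex. -/
def coneAt (k : ℕ) (u : Plane) : Set Plane :=
  {v | v ≠ u ∧ ∃ a b : ℝ, 0 ≤ a ∧ 0 ≤ b ∧
    v - u = a • unitDir (k * Real.pi / 3) + b • unitDir ((k + 1) * Real.pi / 3)}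

/-- The positive cone `C_i` with apex `u`. -/
def positiveCone (i : Fin 3) (u : Plane) : Set Plane := coneAt (2 * i.val + 1) u

/-- The negative cone with apex `u` that is opposite to `C_i`. -/
def negativeCone (i : Fin 3) (u : Plane) : Set Plane := coneAt (2 * i.val + 4) u

/-- The unit vector along the bisector of the positive cone `C_i`; the bisector of the opposite
negative cone points in direction `- bisector i`. -/
def bisector (i : Fin 3) : Plane := unitDir ((2 * i.val + 1) * Real.pi / 3 + Real.pi / 6)

/-- No two points lie on a line parallel to a cone boundary. -/
def GeneralPosition (P : Finset Plane) : Prop :=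
  ∀ u ∈ P, ∀ v ∈ P, u ≠ v → ∀ (k : ℕ) (c : ℝ), v - u ≠ c • unitDir (k * Real.pi / 3)

/-- `v` is the closest vertex to `u` in the positive cone `C_i` of `u`: its projection on the
bisector of that cone is closest to `u`. -/
def IsClosestInCone (P : Finset Plane) (i : Fin 3) (u v : Plane) : Prop :=
  v ∈ P ∧ v ∈ positiveCone i u ∧
    ∀ w ∈ P, w ∈ positiveCone i u →
      inner ℝ (v - u) (bisector i) ≤ inner ℝ (w - u) (bisector i)

/-- The half-θ₆-graph on the point set `P`. (Points of the plane outside `P` are isolated.) -/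
def halfThetaSix (P : Finset Plane) : SimpleGraph Plane where
  Adj u v := u ∈ P ∧ v ∈ P ∧ ∃ i, IsClosestInCone P i u v ∨ IsClosestInCone P i v u
  symm := ⟨fun _ _ ⟨hu, hv, i, h⟩ => ⟨hv, hu, i, h.symm⟩⟩
  loopless := ⟨fun _ ⟨_, _, _, h⟩ => h.elim (fun h => h.2.1.1 rfl) (fun h => h.2.1.1 rfl)⟩

/-- The neighbours of `v` in the half-θ₆-graph that lie in its `i`-th negative cone. -/
def negNeighbors (P : Finset Plane) (i : Fin 3) (v : Plane) : Set Plane :=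
  {x | (halfThetaSix P).Adj v x ∧ x ∈ negativeCone i v}

/-- The planar cross product; for `a`, `b` in a common convex cone it is negative exactly if `b`
comes after `a` in clockwise order. -/
def cross (a b : Plane) : ℝ := a 0 * b 1 - a 1 * b 0

/-- `x` is the first neighbour of `v`, in clockwise order around `v`, in the `i`-th negative cone. -/
def IsFirstNeg (P : Finset Plane) (i : Fin 3) (v x : Plane) : Prop :=
  x ∈ negNeighbors P i v ∧ ∀ y ∈ negNeighbors P i v, cross (x - v) (y - v) ≤ 0

/-- `x` is the last neighbour of `v`, in clockwise order around `v`, in the `i`-th negative cone. -/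
def IsLastNeg (P : Finset Plane) (i : Fin 3) (v x : Plane) : Prop :=
  x ∈ negNeighbors P i v ∧ ∀ y ∈ negNeighbors P i v, 0 ≤ cross (x - v) (y - v)

/-- `x` is, among the neighbours of `v` in the `i`-th negative cone, the one whose projection on the
bisector of that cone is closest to `v`. -/
def IsClosestNeg (P : Finset Plane) (i : Fin 3) (v x : Plane) : Prop :=
  x ∈ negNeighbors P i v ∧ ∀ y ∈ negNeighbors P i v,
    inner ℝ (x - v) (- bisector i) ≤ inner ℝ (y - v) (- bisector i)

/-- The vertex `v` keeps its edge to `x`, a neighbour in one of its negative cones. -/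
def KeepsEdge (P : Finset Plane) (v x : Plane) : Prop :=
  ∃ i, IsFirstNeg P i v x ∨ IsLastNeg P i v x ∨ IsClosestNeg P i v x

/-- The subgraph `G₁₂` of the half-θ₆-graph: in each negative cone of each vertex all edges are
discarded except for the first and the last one in clockwise order and the one to the closest
neighbour. (Every edge lies in a negative cone of exactly one of its endpoints.) -/
def GTwelve (P : Finset Plane) : SimpleGraph Plane where
  Adj u v := (halfThetaSix P).Adj u v ∧ (KeepsEdge P u v ∨ KeepsEdge P v u)
  symm := ⟨fun _ _ h => ⟨h.1.symm, h.2.symm⟩⟩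
  loopless := ⟨fun _ h => h.1.ne rfl⟩

/-- The `k`-neighbourhood of `s`: the vertices reachable by following at most `k` edges. -/
def kNeighborhood (G : SimpleGraph Plane) (k : ℕ) (s : Plane) : Set Plane :=
  {v | ∃ p : G.Walk s v, p.length ≤ k}

/-- One unit of memory: an integer or a point. -/
inductive MemoryUnit : Type
  | int (k : ℕ)
  | point (p : Plane)

/-- The value of a memory unit is admissible for a graph with vertex set `P`, `n = #P`: an integer
has at most `log₂ n` bits (it is one of `0, …, n - 1`), and a point is the position of a vertex.
Arbitrary points are excluded, since one real number could encode the whole history of the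
message. -/
def MemoryUnit.Admissible (P : Finset Plane) : MemoryUnit → Prop
  | .int k => k < P.card
  | .point p => p ∈ P

/-- The memory of size `m` that is stored with the message. -/
abbrev Memory (m : ℕ) : Type := Fin m → MemoryUnit

/-- A deterministic `k`-local, `m`-memory routing algorithm: the next vertex and the next memory
contents are a function of the current vertex `s`, the destination `t`, the `k`-neighbourhood of
`s`, and the memory. -/
structure RoutingAlgorithm (k m : ℕ) where
  step : (s t : Plane) → (N : Set Plane) → Memory m → Plane × Memory m

/-- Position and memory of the message after a number of steps, when routing on `G` from `s` to `t`;
the memory initially contains zeros. -/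
def RoutingAlgorithm.run {k m : ℕ} (A : RoutingAlgorithm k m) (G : SimpleGraph Plane)
    (s t : Plane) : ℕ → Plane × Memory m
  | 0 => (s, fun _ => MemoryUnit.int 0)
  | j + 1 =>
    A.step (A.run G s t j).1 t (kNeighborhood G k (A.run G s t j).1) (A.run G s t j).2

/-- Routing on the graph `G` with vertex set `P` from `s`, the message follows edges of `G` and
arrives at `t` after finitely many steps and a total distance of at most `L`; up to then
all memory contents are admissible. -/
def RoutingAlgorithm.DeliversWithin {k m : ℕ} (A : RoutingAlgorithm k m) (P : Finset Plane)
    (G : SimpleGraph Plane) (s t : Plane) (L : ℝ) : Prop :=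
  ∃ N : ℕ, (A.run G s t N).1 = t ∧
    (∀ j < N, G.Adj (A.run G s t j).1 (A.run G s t (j + 1)).1) ∧
    (∀ j ≤ N, ∀ r, ((A.run G s t j).2 r).Admissible P) ∧
    ∑ j ∈ Finset.range N, dist (A.run G s t j).1 (A.run G s t (j + 1)).1 ≤ L

end

/-!
In suitable linear coordinates, three for each point and with sum zero, an edge of the
half-θ₆-graph is an arc from a vertex `x` to the closest vertex `v` of one of its positive cones.
The tails of the arcs that enter `v` through the same negative cone form a chain, monotone in two of
the coordinates, whose consecutive vertices are adjacent in `G₁₂` and can be recognized locally. Of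
its vertices, `G₁₂` joins only the first, the last and the closest one to `v`. A message that should
follow a discarded arc from `s` to `v` therefore searches the chain in both directions from `s` with
doubling radius. Such a search is 9-competitive; as the way from `s` to the closest vertex along the
chain has length at most `2 * dist s v`, the detour costs at most `19 * dist s v`.

Toward a `t` in a positive cone, the message follows the arc in this cone until `t` is in a negative
one; by then the region on one side is known to be empty. Toward a `t` in a negative cone, the
message takes an arc backwards whenever one of them starts in the cone of `t`, and can move sideways
with a bounded sum of lengths as long as one of the two side regions is known to be empty. If no
such region is known, a search in the smaller one either leads to a vertex there or shows, at a cost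
charged to the decrease of the potential, that it is empty, which is recorded in the memory. The
lengths of the arcs add up to differences of coordinates.
-/

noncomputable section

/-! ### Cone coordinates -/

/-- The `i`-th cone coordinate: the projection on the bisector of the negative cone opposite to
`C_i`, in units of `√3 / 2`. The three coordinates of a point sum to zero, and the positive cone
`C_i` at the origin is the set where the two coordinates other than the `i`-th are nonnegative. -/
def coneCoord (i : Fin 3) : Plane →ₗ[ℝ] ℝ := -(2 / √3) • innerₗ Plane (bisector i)

lemma coneCoord_eq_inner (i : Fin 3) (p : Plane) :
    coneCoord i p = -(2 / √3) * inner ℝ p (bisector i) := by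
  rw [real_inner_comm]
  rfl

lemma inner_bisector (i : Fin 3) (p : Plane) :
    inner ℝ p (bisector i) = -(√3 / 2) * coneCoord i p := by
  rw [coneCoord_eq_inner]
  field_simp

lemma inner_unitDir_unitDir (θ φ : ℝ) :
    inner ℝ (unitDir θ) (unitDir φ) = Real.cos (θ - φ) := by
  simp only [unitDir, PiLp.inner_apply, Fin.sum_univ_two, RCLike.inner_apply, conj_trivial,
    Real.cos_sub, Matrix.cons_val_zero, Matrix.cons_val_one]
  ring

lemma coneCoord_unitDir (i : Fin 3) (θ : ℝ) :
    coneCoord i (unitDir θ) = -(2 / √3) * Real.sin (θ - 2 * i.val * Real.pi / 3) := by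
  rw [coneCoord_eq_inner, bisector, inner_unitDir_unitDir, ← Real.cos_sub_pi_div_two]
  congr 2
  ring

lemma coneCoord_apply (i : Fin 3) (p : Plane) :
    coneCoord i p = ![-(2 * p 1 / √3), p 0 + p 1 / √3, -p 0 + p 1 / √3] i := by
  rw [coneCoord_eq_inner, bisector]
  fin_cases i
  · have hangle : ((2 * (0 : ℕ) + 1) * Real.pi / 3 + Real.pi / 6 : ℝ) = Real.pi / 2 := by
      push_cast; ring
    simp only [Fin.zero_eta, hangle]
    simp [unitDir, PiLp.inner_apply]
    ring
  · have hangle : ((2 * (1 : ℕ) + 1) * Real.pi / 3 + Real.pi / 6 : ℝ) =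
        Real.pi / 6 + Real.pi := by push_cast; ring
    simp only [Fin.mk_one, hangle]
    simp [unitDir, PiLp.inner_apply]
    field_simp
    ring
  · have hangle : ((2 * (2 : ℕ) + 1) * Real.pi / 3 + Real.pi / 6 : ℝ) =
        2 * Real.pi - Real.pi / 6 := by push_cast; ring
    simp only [Fin.reduceFinMk, hangle]
    simp [unitDir, PiLp.inner_apply, Real.cos_two_pi_sub, Real.sin_two_pi_sub]
    field_simp
    ring

/-- Three pairwise distinct cone indices. -/
structure Distinct3 (i j k : Fin 3) : Prop where
  ne₁₂ : i ≠ j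
  ne₁₃ : i ≠ k
  ne₂₃ : j ≠ k

namespace Distinct3

variable {i j k : Fin 3}

lemma swap (h : Distinct3 i j k) : Distinct3 i k j := ⟨h.ne₁₃, h.ne₁₂, h.ne₂₃.symm⟩

lemma rotate (h : Distinct3 i j k) : Distinct3 j k i := ⟨h.ne₂₃, h.ne₁₂.symm, h.ne₁₃.symm⟩

lemma cyclic (i : Fin 3) : Distinct3 i (i + 1) (i + 2) := by
  constructor <;> revert i <;> decide

lemma exists_of_ne (h : i ≠ j) : ∃ k, Distinct3 i j k := by
  obtain ⟨k, hki, hkj⟩ : ∃ k, k ≠ i ∧ k ≠ j := by revert i j; decide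
  exact ⟨k, h, hki.symm, hkj.symm⟩

lemma forall_ne (h : Distinct3 i j k) {Q : Fin 3 → Prop} : (∀ l, l ≠ i → Q l) ↔ Q j ∧ Q k := by
  have cases_ne : ∀ l, l ≠ i → l = j ∨ l = k := by
    obtain ⟨hij, hik, hjk⟩ := h
    omega
  refine ⟨fun H => ⟨H j h.ne₁₂.symm, H k h.ne₁₃.symm⟩, fun ⟨hj, hk⟩ l hl => ?_⟩
  rcases cases_ne l hl with rfl | rfl
  exacts [hj, hk]

lemma exists_ne (h : Distinct3 i j k) {Q : Fin 3 → Prop} : (∃ l, l ≠ i ∧ Q l) ↔ Q j ∨ Q k := by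
  simpa only [not_forall, not_and_or, not_not, exists_prop] using
    (h.forall_ne (Q := fun l => ¬ Q l)).not

lemma sum_eq_zero (h : Distinct3 i j k) (p : Plane) :
    coneCoord i p + coneCoord j p + coneCoord k p = 0 := by
  obtain ⟨hij, hik, hjk⟩ := h
  simp only [coneCoord_apply]
  fin_cases i <;> fin_cases j <;> fin_cases k <;> simp at hij hik hjk ⊢ <;> ring

end Distinct3

lemma cross_eq (i : Fin 3) (a b : Plane) :
    cross a b = √3 / 2 * (coneCoord (i + 1) a * coneCoord (i + 2) b -
      coneCoord (i + 2) a * coneCoord (i + 1) b) := by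
  simp only [cross, coneCoord_apply]
  fin_cases i <;> simp <;> field_simp <;> ring

lemma norm_sq_eq_coneCoord {j k : Fin 3} (h : j ≠ k) (p : Plane) :
    ‖p‖ ^ 2 = coneCoord j p ^ 2 + coneCoord k p ^ 2 + coneCoord j p * coneCoord k p := by
  have h3 : (√3 : ℝ) ^ 2 = 3 := by norm_num
  simp only [EuclideanSpace.real_norm_sq_eq, Fin.sum_univ_two, coneCoord_apply]
  fin_cases j <;> fin_cases k <;> simp at h ⊢ <;> field_simp <;>
    linear_combination p 1 ^ 2 * h3

section Metric

variable {j k : Fin 3} (h : j ≠ k) (p q : Plane)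
include h

lemma dist_sq_eq :
    dist p q ^ 2 = (coneCoord j q - coneCoord j p) ^ 2 + (coneCoord k q - coneCoord k p) ^ 2
      + (coneCoord j q - coneCoord j p) * (coneCoord k q - coneCoord k p) := by
  rw [dist_comm, dist_eq_norm, norm_sq_eq_coneCoord h, map_sub, map_sub]

lemma dist_le_add :
    dist p q ≤ |coneCoord j q - coneCoord j p| + |coneCoord k q - coneCoord k p| := by
  refine le_of_sq_le_sq ?_ (by positivity)
  rw [dist_sq_eq h, add_sq, sq_abs, sq_abs]
  generalize coneCoord j q - coneCoord j p = a, coneCoord k q - coneCoord k p = b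
  have hab : a * b ≤ |a| * |b| := (le_abs_self _).trans_eq (abs_mul a b)
  have := mul_nonneg (abs_nonneg a) (abs_nonneg b)
  linarith

lemma add_half_le_dist :
    coneCoord j q - coneCoord j p + (coneCoord k q - coneCoord k p) / 2 ≤ dist p q := by
  refine le_of_sq_le_sq ?_ dist_nonneg
  rw [dist_sq_eq h]
  linarith [sq_nonneg (coneCoord k q - coneCoord k p)]

end Metric

lemma eq_of_coneCoord_eq {j k : Fin 3} (h : j ≠ k) {p q : Plane}
    (hj : coneCoord j p = coneCoord j q) (hk : coneCoord k p = coneCoord k q) : p = q := by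
  have hdist : dist p q ^ 2 = 0 := by simp [dist_sq_eq h, hj, hk]
  simpa using hdist

/-! ### Cones in coordinates -/

lemma unitDir_add_pi (θ : ℝ) : unitDir (θ + Real.pi) = -unitDir θ := by
  ext l
  fin_cases l <;> simp [unitDir]

lemma mem_coneAt_add_three {k : ℕ} {u v : Plane} : v ∈ coneAt (k + 3) u ↔ u ∈ coneAt k v := by
  have opposite : ∀ x : ℝ, unitDir ((x + 3) * Real.pi / 3) = -unitDir (x * Real.pi / 3) := by
    intro x
    rw [← unitDir_add_pi]
    congr 1
    ring
  have opposite_succ := opposite (k + 1)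
  rw [add_right_comm] at opposite_succ
  simp only [coneAt, Set.mem_ofPred_eq, Nat.cast_add, Nat.cast_ofNat, opposite, opposite_succ]
  refine and_congr ne_comm (exists_congr fun a => exists_congr fun b =>
    and_congr_right fun _ => and_congr_right fun _ => ?_)
  rw [← neg_inj (a := v - u), neg_sub]
  simp only [smul_neg, neg_add, neg_neg]

lemma mem_negativeCone {i : Fin 3} {u v : Plane} :
    v ∈ negativeCone i u ↔ u ∈ positiveCone i v :=
  mem_coneAt_add_three (k := 2 * i.val + 1)

lemma coneCoord_add_ray (i d : Fin 3) (m : ℝ) :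
    coneCoord (i + d) (unitDir ((2 * i.val + m) * Real.pi / 3)) =
      2 / √3 * Real.sin ((2 * d.val - m) * Real.pi / 3) := by
  rw [coneCoord_unitDir, neg_mul, ← mul_neg, ← Real.sin_neg]
  congr 1
  have hval : (i + d).val = i.val + d.val ∨ (i + d).val + 3 = i.val + d.val := by omega
  rcases hval with h | h <;> have h' := congrArg (Nat.cast : ℕ → ℝ) h <;> push_cast at h'
  · congr 1
    linear_combination (2 * Real.pi / 3) * h'
  · rw [← Real.sin_add_two_pi]
    congr 1
    linear_combination (2 * Real.pi / 3) * h'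

lemma two_div_sqrt_three_mul_sin_pi_div_three : 2 / √3 * Real.sin (Real.pi / 3) = 1 := by
  rw [Real.sin_pi_div_three]
  field_simp

lemma two_div_sqrt_three_mul_sin_two_pi_div_three :
    2 / √3 * Real.sin (2 * Real.pi / 3) = 1 := by
  rw [show 2 * Real.pi / 3 = Real.pi - Real.pi / 3 by ring, Real.sin_pi_sub,
    two_div_sqrt_three_mul_sin_pi_div_three]

lemma eq_smul_ray_iff {i : Fin 3} {c : ℝ} {p : Plane} :
    p = c • unitDir (2 * i.val * Real.pi / 3) ↔
      coneCoord i p = 0 ∧ coneCoord (i + 1) p = c := by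
  have h0 : coneCoord i (unitDir (2 * i.val * Real.pi / 3)) = 0 := by
    simpa using coneCoord_add_ray i 0 0
  have h1 : coneCoord (i + 1) (unitDir (2 * i.val * Real.pi / 3)) = 1 := by
    simpa [two_div_sqrt_three_mul_sin_two_pi_div_three] using coneCoord_add_ray i 1 0
  constructor
  · rintro rfl
    simp [h0, h1]
  · rintro ⟨hi, hc⟩
    refine eq_of_coneCoord_eq (Distinct3.cyclic i).ne₁₂ ?_ ?_ <;> simp [h0, h1, hi, hc]

lemma eq_smul_add_smul_ray_iff {i : Fin 3} {a b : ℝ} {p : Plane} :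
    p = a • unitDir ((2 * i.val + 1) * Real.pi / 3)
        + b • unitDir ((2 * i.val + 2) * Real.pi / 3) ↔
      coneCoord (i + 1) p = a ∧ coneCoord (i + 2) p = b := by
  have h11 : coneCoord (i + 1) (unitDir ((2 * i.val + 1) * Real.pi / 3)) = 1 := by
    norm_num [coneCoord_add_ray, two_div_sqrt_three_mul_sin_pi_div_three]
  have h12 : coneCoord (i + 1) (unitDir ((2 * i.val + 2) * Real.pi / 3)) = 0 := by
    norm_num [coneCoord_add_ray]
  have h21 : coneCoord (i + 2) (unitDir ((2 * i.val + 1) * Real.pi / 3)) = 0 := by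
    norm_num [coneCoord_add_ray]
  have h22 : coneCoord (i + 2) (unitDir ((2 * i.val + 2) * Real.pi / 3)) = 1 := by
    norm_num [coneCoord_add_ray, two_div_sqrt_three_mul_sin_two_pi_div_three]
  constructor
  · rintro rfl
    simp [h11, h12, h21, h22]
  · rintro ⟨ha, hb⟩
    refine eq_of_coneCoord_eq (Distinct3.cyclic i).ne₂₃ ?_ ?_ <;>
      simp [h11, h12, h21, h22, ha, hb]

/-- `v` lies in the closed positive cone `C_i` with apex `u` (the apex included). -/
def InClosedCone (i : Fin 3) (u v : Plane) : Prop := ∀ j, j ≠ i → coneCoord j u ≤ coneCoord j v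

/-- `v` lies in the interior of the positive cone `C_i` with apex `u`. -/
def InCone (i : Fin 3) (u v : Plane) : Prop := ∀ j, j ≠ i → coneCoord j u < coneCoord j v

lemma mem_positiveCone {i : Fin 3} {u v : Plane} :
    v ∈ positiveCone i u ↔ v ≠ u ∧ InClosedCone i u v := by
  refine and_congr_right fun _ => ?_
  push_cast
  simp only [add_assoc, one_add_one_eq_two, eq_smul_add_smul_ray_iff, InClosedCone,
    (Distinct3.cyclic i).forall_ne, map_sub]
  constructor
  · rintro ⟨a, b, ha, hb, h₁, h₂⟩
    constructor <;> linarith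
  · rintro ⟨h₁, h₂⟩
    exact ⟨_, _, sub_nonneg.2 h₁, sub_nonneg.2 h₂, rfl, rfl⟩

lemma GeneralPosition.coneCoord_ne {P : Finset Plane} (h : GeneralPosition P) {u v : Plane}
    (hu : u ∈ P) (hv : v ∈ P) (hne : u ≠ v) (i : Fin 3) : coneCoord i u ≠ coneCoord i v := by
  intro heq
  refine h u hu v hv hne (2 * i.val) (coneCoord (i + 1) (v - u)) ?_
  push_cast
  exact eq_smul_ray_iff.2 ⟨by rw [map_sub, heq, sub_self], rfl⟩

section Cones

variable {i : Fin 3} {u v w : Plane}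

lemma InCone.inClosedCone (h : InCone i u v) : InClosedCone i u v := fun j hj => (h j hj).le

lemma InClosedCone.refl (i : Fin 3) (u : Plane) : InClosedCone i u u := fun _ _ => le_rfl

lemma InClosedCone.trans (h : InClosedCone i u v) (h' : InClosedCone i v w) :
    InClosedCone i u w := fun j hj => (h j hj).trans (h' j hj)

lemma Distinct3.inCone_iff {i j k : Fin 3} (h : Distinct3 i j k) :
    InCone i u v ↔ coneCoord j u < coneCoord j v ∧ coneCoord k u < coneCoord k v :=
  h.forall_ne

lemma Distinct3.inClosedCone_iff {i j k : Fin 3} (h : Distinct3 i j k) :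
    InClosedCone i u v ↔ coneCoord j u ≤ coneCoord j v ∧ coneCoord k u ≤ coneCoord k v :=
  h.forall_ne

lemma InCone.lt (h : InCone i u v) : coneCoord i v < coneCoord i u := by
  have hd := Distinct3.cyclic i
  linarith [(hd.inCone_iff.1 h).1, (hd.inCone_iff.1 h).2, hd.sum_eq_zero u, hd.sum_eq_zero v]

lemma InCone.ne (h : InCone i u v) : u ≠ v := by
  rintro rfl
  exact lt_irrefl _ h.lt

lemma InCone.index_unique {i' : Fin 3} (h : InCone i u v) (h' : InCone i' u v) : i = i' := by
  by_contra hne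
  exact lt_asymm h.lt (h' i hne)

lemma InCone.not_inCone_swap {i' : Fin 3} (h : InCone i u v) : ¬ InCone i' v u := by
  intro h'
  rcases eq_or_ne i i' with rfl | hne
  · exact lt_asymm h.lt h'.lt
  · obtain ⟨k, hd⟩ := Distinct3.exists_of_ne hne
    exact lt_asymm (h k hd.ne₁₃.symm) (h' k hd.ne₂₃.symm)

lemma cross_sub_pos {x y : Plane} (hx : InCone i x v) (hy : InCone i y v)
    (h₁ : coneCoord (i + 1) x < coneCoord (i + 1) y)
    (h₂ : coneCoord (i + 2) y < coneCoord (i + 2) x) : 0 < cross (x - v) (y - v) := by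
  have hx₁ := ((Distinct3.cyclic i).inCone_iff.1 hx).2
  have hy₁ := ((Distinct3.cyclic i).inCone_iff.1 hy).1
  rw [cross_eq i]
  simp only [map_sub]
  refine mul_pos (by positivity) ?_
  nlinarith [mul_pos (sub_pos.2 h₁) (sub_pos.2 hx₁), mul_pos (sub_pos.2 h₂) (sub_pos.2 hy₁)]

end Cones

section GeneralPosition

variable {P : Finset Plane} (hP : GeneralPosition P) {i : Fin 3} {u v : Plane}
include hP

lemma GeneralPosition.inCone_of_inClosedCone (hu : u ∈ P) (hv : v ∈ P) (hne : u ≠ v)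
    (h : InClosedCone i u v) : InCone i u v :=
  fun j hj => lt_of_le_of_ne (h j hj) (hP.coneCoord_ne hu hv hne j)

lemma GeneralPosition.mem_positiveCone_iff (hu : u ∈ P) (hv : v ∈ P) :
    v ∈ positiveCone i u ↔ InCone i u v := by
  rw [mem_positiveCone]
  exact ⟨fun h => hP.inCone_of_inClosedCone hu hv h.1.symm h.2,
    fun h => ⟨h.ne.symm, h.inClosedCone⟩⟩

lemma GeneralPosition.inCone_cases (hu : u ∈ P) (hv : v ∈ P) (hne : u ≠ v) :
    ∃ i, InCone i u v ∨ InCone i v u := by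
  have d : Distinct3 0 1 2 := Distinct3.cyclic 0
  have hu0 := d.sum_eq_zero u
  have hv0 := d.sum_eq_zero v
  have hne := hP.coneCoord_ne hu hv hne
  rcases lt_or_gt_of_ne (hne 0) with h0 | h0 <;> rcases lt_or_gt_of_ne (hne 1) with h1 | h1 <;>
    rcases lt_or_gt_of_ne (hne 2) with h2 | h2
  · linarith
  · exact ⟨2, .inl (d.rotate.rotate.inCone_iff.2 ⟨h0, h1⟩)⟩
  · exact ⟨1, .inl (d.rotate.inCone_iff.2 ⟨h2, h0⟩)⟩
  · exact ⟨0, .inr (d.inCone_iff.2 ⟨h1, h2⟩)⟩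
  · exact ⟨0, .inl (d.inCone_iff.2 ⟨h1, h2⟩)⟩
  · exact ⟨1, .inr (d.rotate.inCone_iff.2 ⟨h2, h0⟩)⟩
  · exact ⟨2, .inr (d.rotate.rotate.inCone_iff.2 ⟨h0, h1⟩)⟩
  · linarith

end GeneralPosition

/-! ### Canonical chains and the arcs of the two graphs -/

/-- `x` is on the canonical chain of the anchor `v`: the cone `C_i` of `x` contains `v` and no
vertex closer than `v`. The anchor need not be a vertex. -/
structure OnChain (P : Finset Plane) (i : Fin 3) (v x : Plane) : Prop where
  mem : x ∈ P
  inCone : InCone i x v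
  le_of_inCone : ∀ w ∈ P, InCone i x w → coneCoord i w ≤ coneCoord i v

/-- The half-θ₆-graph has an edge from `x` to the closest vertex `v` of its positive cone `C_i`. -/
structure Arc (P : Finset Plane) (i : Fin 3) (x v : Plane) : Prop extends OnChain P i v x where
  mem_head : v ∈ P

/-- The arc from `x` to `v` belongs to `G₁₂`: among the arcs that enter `v` through the same
negative cone it is the first one, the last one, or the one from the closest vertex. -/
structure KeptArc (P : Finset Plane) (i : Fin 3) (x v : Plane) : Prop extends Arc P i x v where
  extreme_or_closest :
    (∃ j ≠ i, ∀ y, Arc P i y v → coneCoord j y ≤ coneCoord j x) ∨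
      ∀ y, Arc P i y v → coneCoord i x ≤ coneCoord i y

/-- `v` is a point whose canonical chain in direction `i` is used: a vertex, or a point so far out
that it lies in the cone `C_i` of every vertex. -/
def IsAnchor (P : Finset Plane) (i : Fin 3) (v : Plane) : Prop := v ∈ P ∨ ∀ y ∈ P, InCone i y v

section Chain

variable {P : Finset Plane} {i j k : Fin 3} {u v w x y z : Plane}

lemma OnChain.arc (h : OnChain P i v x) (hv : v ∈ P) : Arc P i x v := ⟨h, hv⟩

lemma OnChain.not_inCone (hx : OnChain P i v x) (hy : OnChain P i v y) : ¬ InCone i x y :=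
  fun h => hy.inCone.lt.not_ge (hx.le_of_inCone y hy.mem h)

lemma exists_arc (hu : u ∈ P) (hv : v ∈ P) (h : InCone i u v) :
    ∃ w, Arc P i u w ∧ coneCoord i v ≤ coneCoord i w := by
  classical
  obtain ⟨w, hw, hmax⟩ := (P.filter fun w => InCone i u w).exists_max_image (coneCoord i)
    ⟨v, Finset.mem_filter.2 ⟨hv, h⟩⟩
  rw [Finset.mem_filter] at hw
  exact ⟨w, ⟨⟨hu, hw.2, fun z hz hz' => hmax z (Finset.mem_filter.2 ⟨hz, hz'⟩)⟩, hw.1⟩,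
    hmax v (Finset.mem_filter.2 ⟨hv, h⟩)⟩

lemma exists_onChain_above (hz : z ∈ P) (hvz : coneCoord i v < coneCoord i z)
    (hcone : ∀ q ∈ P, InClosedCone i z q → coneCoord i v < coneCoord i q → InCone i q v) :
    ∃ q, OnChain P i v q ∧ InClosedCone i z q := by
  classical
  obtain ⟨q, hq, hmin⟩ :=
    (P.filter fun q => InClosedCone i z q ∧ coneCoord i v < coneCoord i q).exists_min_image
      (coneCoord i) ⟨z, Finset.mem_filter.2 ⟨hz, .refl i z, hvz⟩⟩
  obtain ⟨hqP, hzq, hvq⟩ := Finset.mem_filter.1 hq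
  refine ⟨q, ⟨hqP, hcone q hqP hzq hvq, fun w hw hqw => ?_⟩, hzq⟩
  by_contra! hlt
  exact hqw.lt.not_ge
    (hmin w (Finset.mem_filter.2 ⟨hw, hzq.trans hqw.inClosedCone, hlt⟩))

lemma exists_anchor_forall_inCone (P : Finset Plane) (i : Fin 3) : ∃ v, ∀ y ∈ P, InCone i y v := by
  have exists_bound (j : Fin 3) : ∃ M, ∀ y ∈ P, coneCoord j y < M := by
    obtain ⟨M, hM⟩ := (P.image (coneCoord j)).exists_le
    exact ⟨M + 1, fun y hy => (hM _ (Finset.mem_image_of_mem _ hy)).trans_lt (lt_add_one M)⟩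
  obtain ⟨M₁, hM₁⟩ := exists_bound (i + 1)
  obtain ⟨M₂, hM₂⟩ := exists_bound (i + 2)
  obtain ⟨v, hv₁, hv₂⟩ : ∃ v, coneCoord (i + 1) v = M₁ ∧ coneCoord (i + 2) v = M₂ :=
    ⟨_, eq_smul_add_smul_ray_iff.1 rfl⟩
  exact ⟨v, fun y hy => (Distinct3.cyclic i).inCone_iff.2 ⟨hv₁ ▸ hM₁ y hy, hv₂ ▸ hM₂ y hy⟩⟩

section GeneralPosition

variable (hP : GeneralPosition P)
include hP

lemma Arc.head_unique (h : Arc P i u v) (h' : Arc P i u w) : v = w := by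
  by_contra hne
  exact hP.coneCoord_ne h.mem_head h'.mem_head hne i
    (le_antisymm (h'.le_of_inCone v h.mem_head h.inCone) (h.le_of_inCone w h'.mem_head h'.inCone))

lemma IsAnchor.mem_and_lt (hv : IsAnchor P i v) (hy : y ∈ P) (hne : y ≠ v)
    (h : coneCoord i y ≤ coneCoord i v) : v ∈ P ∧ coneCoord i y < coneCoord i v := by
  rcases hv with hv | hv
  · exact ⟨hv, lt_of_le_of_ne h (hP.coneCoord_ne hy hv hne i)⟩
  · exact absurd h (hv y hy).lt.not_ge

lemma OnChain.lt_iff (hd : Distinct3 i j k) (hx : OnChain P i v x) (hy : OnChain P i v y) :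
    coneCoord j x < coneCoord j y ↔ coneCoord k y < coneCoord k x := by
  rcases eq_or_ne x y with rfl | hne
  · simp
  have hj := (hP.coneCoord_ne hx.mem hy.mem hne j).lt_or_gt
  have hk := (hP.coneCoord_ne hx.mem hy.mem hne k).lt_or_gt
  constructor
  · exact fun h => hk.resolve_left fun h' => hx.not_inCone hy (hd.inCone_iff.2 ⟨h, h'⟩)
  · exact fun h => hj.resolve_right fun h' => hy.not_inCone hx (hd.inCone_iff.2 ⟨h', h⟩)

lemma OnChain.le_iff (hd : Distinct3 i j k) (hx : OnChain P i v x) (hy : OnChain P i v y) :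
    coneCoord j x ≤ coneCoord j y ↔ coneCoord k y ≤ coneCoord k x := by
  rw [← not_lt, ← not_lt, hy.lt_iff hP hd hx]

lemma GeneralPosition.isClosestInCone_iff :
    u ∈ P ∧ IsClosestInCone P i u v ↔ Arc P i u v := by
  have hle : ∀ w, inner ℝ (v - u) (bisector i) ≤ inner ℝ (w - u) (bisector i) ↔
      coneCoord i w ≤ coneCoord i v := by
    intro w
    rw [inner_bisector, inner_bisector, map_sub, map_sub, neg_mul, neg_mul, neg_le_neg_iff,
      mul_le_mul_iff_of_pos_left (by positivity), sub_le_sub_iff_right]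
  simp only [IsClosestInCone, hle]
  constructor
  · rintro ⟨hu, hv, hcone, hmax⟩
    exact ⟨⟨hu, (hP.mem_positiveCone_iff hu hv).1 hcone,
      fun w hw huw => hmax w hw ((hP.mem_positiveCone_iff hu hw).2 huw)⟩, hv⟩
  · intro h
    exact ⟨h.mem, h.mem_head, (hP.mem_positiveCone_iff h.mem h.mem_head).2 h.inCone,
      fun w hw huw => h.le_of_inCone w hw ((hP.mem_positiveCone_iff h.mem hw).1 huw)⟩

lemma GeneralPosition.halfThetaSix_adj_iff :
    (halfThetaSix P).Adj u v ↔ ∃ i, Arc P i u v ∨ Arc P i v u := by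
  simp only [← hP.isClosestInCone_iff]
  constructor
  · rintro ⟨hu, hv, i, h⟩
    exact ⟨i, h.imp (⟨hu, ·⟩) (⟨hv, ·⟩)⟩
  · rintro ⟨i, ⟨hu, h⟩ | ⟨hv, h⟩⟩
    exacts [⟨hu, h.1, i, .inl h⟩, ⟨h.1, hv, i, .inr h⟩]

lemma GeneralPosition.mem_negNeighbors_iff : x ∈ negNeighbors P i v ↔ Arc P i x v := by
  rw [negNeighbors, Set.mem_ofPred_eq, hP.halfThetaSix_adj_iff, mem_negativeCone]
  constructor
  · rintro ⟨⟨l, h | h⟩, hc⟩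
    · rw [hP.mem_positiveCone_iff h.mem_head h.mem] at hc
      exact absurd h.inCone hc.not_inCone_swap
    · rw [hP.mem_positiveCone_iff h.mem h.mem_head] at hc
      exact hc.index_unique h.inCone ▸ h
  · intro h
    exact ⟨⟨i, .inr h⟩, (hP.mem_positiveCone_iff h.mem h.mem_head).2 h.inCone⟩

lemma Arc.cross_nonpos_iff (hx : Arc P i x v) (hy : Arc P i y v) :
    cross (x - v) (y - v) ≤ 0 ↔ coneCoord (i + 1) y ≤ coneCoord (i + 1) x := by
  have hlt := hx.lt_iff hP (Distinct3.cyclic i) hy.toOnChain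
  have hgt := hy.lt_iff hP (Distinct3.cyclic i) hx.toOnChain
  rcases lt_trichotomy (coneCoord (i + 1) x) (coneCoord (i + 1) y) with h | h | h
  · exact iff_of_false (cross_sub_pos hx.inCone hy.inCone h (hlt.1 h)).not_ge h.not_ge
  · obtain rfl : x = y := by
      by_contra hne
      exact hP.coneCoord_ne hx.mem hy.mem hne _ h
    simp [cross, mul_comm]
  · have hpos := cross_sub_pos hy.inCone hx.inCone h (hgt.1 h)
    refine iff_of_true ?_ h.le
    simp only [cross] at hpos ⊢
    linarith

lemma Arc.cross_nonneg_iff (hx : Arc P i x v) (hy : Arc P i y v) :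
    0 ≤ cross (x - v) (y - v) ↔ coneCoord (i + 2) y ≤ coneCoord (i + 2) x := by
  have hanti : cross (y - v) (x - v) = -cross (x - v) (y - v) := by
    simp only [cross]
    ring
  rw [← hx.le_iff hP (Distinct3.cyclic i) hy.toOnChain, ← hy.cross_nonpos_iff hP hx, hanti,
    neg_nonpos]

lemma GeneralPosition.isFirstNeg_iff : IsFirstNeg P i v x ↔
    Arc P i x v ∧ ∀ y, Arc P i y v → coneCoord (i + 1) y ≤ coneCoord (i + 1) x := by
  simp only [IsFirstNeg, hP.mem_negNeighbors_iff]
  exact and_congr_right fun hx => forall₂_congr fun y hy => hx.cross_nonpos_iff hP hy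

lemma GeneralPosition.isLastNeg_iff : IsLastNeg P i v x ↔
    Arc P i x v ∧ ∀ y, Arc P i y v → coneCoord (i + 2) y ≤ coneCoord (i + 2) x := by
  simp only [IsLastNeg, hP.mem_negNeighbors_iff]
  exact and_congr_right fun hx => forall₂_congr fun y hy => hx.cross_nonneg_iff hP hy

lemma GeneralPosition.isClosestNeg_iff : IsClosestNeg P i v x ↔
    Arc P i x v ∧ ∀ y, Arc P i y v → coneCoord i x ≤ coneCoord i y := by
  have hle : ∀ x y, inner ℝ (x - v) (-bisector i) ≤ inner ℝ (y - v) (-bisector i) ↔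
      coneCoord i x ≤ coneCoord i y := by
    intro x y
    rw [inner_neg_right, inner_neg_right, inner_bisector, inner_bisector, neg_mul, neg_mul,
      neg_neg, neg_neg, mul_le_mul_iff_of_pos_left (by positivity), map_sub, map_sub,
      sub_le_sub_iff_right]
  simp only [IsClosestNeg, hP.mem_negNeighbors_iff, hle]

lemma GeneralPosition.keepsEdge_iff : KeepsEdge P v x ↔ ∃ i, KeptArc P i x v := by
  refine exists_congr fun i => ?_
  have hd := Distinct3.cyclic i
  rw [hP.isFirstNeg_iff, hP.isLastNeg_iff, hP.isClosestNeg_iff]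
  constructor
  · rintro (⟨h, hext⟩ | ⟨h, hext⟩ | ⟨h, hclosest⟩)
    exacts [⟨h, .inl ⟨i + 1, hd.ne₁₂.symm, hext⟩⟩, ⟨h, .inl ⟨i + 2, hd.ne₁₃.symm, hext⟩⟩,
      ⟨h, .inr hclosest⟩]
  · rintro ⟨h, ⟨j, hj, hext⟩ | hclosest⟩
    · have hext_or := (hd.exists_ne (Q := fun j => ∀ y, Arc P i y v →
        coneCoord j y ≤ coneCoord j x)).1 ⟨j, hj, hext⟩
      tauto
    · tauto

lemma GeneralPosition.gTwelve_adj_iff :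
    (GTwelve P).Adj u v ↔ ∃ i, KeptArc P i u v ∨ KeptArc P i v u := by
  have hadj : (GTwelve P).Adj u v ↔
      (halfThetaSix P).Adj u v ∧ (KeepsEdge P u v ∨ KeepsEdge P v u) := Iff.rfl
  rw [hadj, hP.halfThetaSix_adj_iff, hP.keepsEdge_iff, hP.keepsEdge_iff, ← exists_or]
  constructor
  · rintro ⟨-, i, h⟩
    exact ⟨i, h.symm⟩
  · rintro ⟨i, h⟩
    exact ⟨⟨i, h.imp (·.toArc) (·.toArc)⟩, i, h.symm⟩

end GeneralPosition

end Chain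

/-! ### Walking along a canonical chain -/

/-- `x'` follows `x` on the chain of `v` in the direction in which the `j`-th coordinate grows. -/
structure ChainSucc (P : Finset Plane) (i j : Fin 3) (v x x' : Plane) : Prop where
  left : OnChain P i v x
  right : OnChain P i v x'
  lt : coneCoord j x < coneCoord j x'
  le_of_lt : ∀ z, OnChain P i v z → coneCoord j x < coneCoord j z → coneCoord j x' ≤ coneCoord j z

/-- The neighbourhood of `x` in `G₁₂`. -/
abbrev nbhd (P : Finset Plane) (x : Plane) : Set Plane := kNeighborhood (GTwelve P) 1 x

/-- The local rule for the vertex `y` after `x` on a chain in the direction of growing `j`-th and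
decreasing `k`-th coordinate, where `N` is the neighbourhood of `x`: the last arc into `x` through
the negative cone on that side, or else the arc out of `x` through the positive cone. -/
def IsNext (N : Set Plane) (j k : Fin 3) (x y : Plane) : Prop :=
  (y ∈ N ∧ InCone j y x ∧ ∀ z ∈ N, InCone j z x → coneCoord k z ≤ coneCoord k y) ∨
    ((∀ z ∈ N, ¬ InCone j z x) ∧ y ∈ N ∧ InCone k x y)

lemma mem_kNeighborhood_one {G : SimpleGraph Plane} {u v : Plane} :
    v ∈ kNeighborhood G 1 u ↔ v = u ∨ G.Adj u v := by
  constructor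
  · rintro ⟨p, hp⟩
    cases p with
    | nil => exact .inl rfl
    | cons h q =>
      cases q with
      | nil => exact .inr h
      | cons h' q' => simp at hp
  · rintro (rfl | h)
    · exact ⟨.nil, by simp⟩
    · exact ⟨h.toWalk, by simp⟩

section Chain

variable {P : Finset Plane} {i j k : Fin 3} {v x x' y z : Plane}

lemma OnChain.exists_succ (hx : OnChain P i v x) (hy : OnChain P i v y)
    (h : coneCoord j x < coneCoord j y) : ∃ x', ChainSucc P i j v x x' := by
  classical
  obtain ⟨z, hz, hmin⟩ := (P.filter fun z => OnChain P i v z ∧ coneCoord j x < coneCoord j z)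
    |>.exists_min_image (coneCoord j) ⟨y, Finset.mem_filter.2 ⟨hy.mem, hy, h⟩⟩
  obtain ⟨-, hzv, hxz⟩ := Finset.mem_filter.1 hz
  exact ⟨z, hx, hzv, hxz, fun w hw hlt => hmin w (Finset.mem_filter.2 ⟨hw.mem, hw, hlt⟩)⟩

section GeneralPosition

variable (hP : GeneralPosition P)
include hP

lemma GeneralPosition.mem_nbhd_and_inCone_iff : y ∈ nbhd P x ∧ InCone i x y ↔ KeptArc P i x y := by
  rw [mem_kNeighborhood_one, hP.gTwelve_adj_iff]
  constructor
  · rintro ⟨rfl | ⟨l, h | h⟩, hc⟩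
    · exact absurd rfl hc.ne
    · exact h.inCone.index_unique hc ▸ h
    · exact absurd h.inCone hc.not_inCone_swap
  · exact fun h => ⟨.inr ⟨i, .inl h⟩, h.inCone⟩

lemma GeneralPosition.mem_nbhd_and_inCone_swap_iff :
    y ∈ nbhd P x ∧ InCone i y x ↔ KeptArc P i y x := by
  rw [← hP.mem_nbhd_and_inCone_iff, mem_kNeighborhood_one, mem_kNeighborhood_one, eq_comm,
    SimpleGraph.adj_comm]

lemma GeneralPosition.isNext_iff : IsNext (nbhd P x) j k x y ↔
    (KeptArc P j y x ∧ ∀ z, KeptArc P j z x → coneCoord k z ≤ coneCoord k y) ∨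
      (∀ z, ¬ KeptArc P j z x) ∧ KeptArc P k x y := by
  rw [← hP.mem_nbhd_and_inCone_iff (i := k)]
  simp only [← hP.mem_nbhd_and_inCone_swap_iff, IsNext, not_and, and_imp, and_assoc]

lemma IsNext.unique (hy : IsNext (nbhd P x) j k x y) (hz : IsNext (nbhd P x) j k x z) : y = z := by
  rcases hP.isNext_iff.1 hy with ⟨hy, hmax⟩ | ⟨hnone, hy⟩ <;>
    rcases hP.isNext_iff.1 hz with ⟨hz, hmax'⟩ | ⟨hnone', hz⟩
  · by_contra hne
    exact hP.coneCoord_ne hy.mem hz.mem hne k (le_antisymm (hmax' _ hy) (hmax _ hz))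
  · exact absurd hy (hnone' _)
  · exact absurd hz (hnone _)
  · exact hy.head_unique hP hz.toArc

lemma IsNext.adj (h : IsNext (nbhd P x) j k x y) : (GTwelve P).Adj x y := by
  rw [hP.gTwelve_adj_iff]
  rcases hP.isNext_iff.1 h with ⟨h, -⟩ | ⟨-, h⟩
  exacts [⟨_, .inr h⟩, ⟨_, .inl h⟩]

lemma IsNext.mem_and_lt (hjk : j ≠ k) (h : IsNext (nbhd P x) j k x y) :
    y ∈ P ∧ coneCoord j x < coneCoord j y ∧ coneCoord k y < coneCoord k x := by
  rcases hP.isNext_iff.1 h with ⟨h, -⟩ | ⟨-, h⟩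
  · exact ⟨h.mem, h.inCone.lt, h.inCone k hjk.symm⟩
  · exact ⟨h.mem_head, h.inCone j hjk, h.inCone.lt⟩

lemma ChainSucc.swap (hd : Distinct3 i j k) (h : ChainSucc P i j v x x') :
    ChainSucc P i k v x' x := by
  refine ⟨h.right, h.left, (h.left.lt_iff hP hd h.right).1 h.lt, fun z hz hlt => ?_⟩
  by_contra! hzx
  exact (h.le_of_lt z hz ((h.left.lt_iff hP hd hz).2 hzx)).not_gt
    ((hz.lt_iff hP hd h.right).2 hlt)

lemma ChainSucc.gap_empty (hd : Distinct3 i j k) (h : ChainSucc P i j v x x') (hz : z ∈ P)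
    (hj : coneCoord j x < coneCoord j z) (hk : coneCoord k x' < coneCoord k z) :
    coneCoord i z ≤ coneCoord i v := by
  by_contra! hvz
  obtain ⟨q, hq, hzq⟩ := exists_onChain_above (v := v) hz hvz fun q hq hzq hvq => by
    obtain ⟨hzj, hzk⟩ := hd.inClosedCone_iff.1 hzq
    have hqk : coneCoord k q ≤ coneCoord k x := by
      by_contra! hlt
      exact (h.left.le_of_inCone q hq (hd.inCone_iff.2 ⟨hj.trans_le hzj, hlt⟩)).not_gt hvq
    have hqj : coneCoord j q ≤ coneCoord j x' := by
      by_contra! hlt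
      exact (h.right.le_of_inCone q hq (hd.inCone_iff.2 ⟨hlt, hk.trans_le hzk⟩)).not_gt hvq
    exact hd.inCone_iff.2 ⟨hqj.trans_lt (hd.inCone_iff.1 h.right.inCone).1,
      hqk.trans_lt (hd.inCone_iff.1 h.left.inCone).2⟩
  obtain ⟨hzj, hzk⟩ := hd.inClosedCone_iff.1 hzq
  have hle := h.le_of_lt q hq (hj.trans_le hzj)
  exact ((h.right.le_iff hP hd hq).1 hle).not_gt (hk.trans_le hzk)

section InCone

variable (hd : Distinct3 i j k) (hv : IsAnchor P i v) (h : ChainSucc P i j v x x')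
include hd hv h

lemma ChainSucc.le_of_arc (hy : Arc P k y x') : coneCoord j y ≤ coneCoord j x := by
  by_contra! hlt
  have hk := hd.rotate.rotate
  have hx'v := hd.inCone_iff.1 h.right.inCone
  have hyv := h.gap_empty hP hd hy.mem hlt hy.inCone.lt
  have hne : y ≠ v := by
    rintro rfl
    exact lt_asymm (hk.inCone_iff.1 hy.inCone).2 hx'v.1
  obtain ⟨hvP, hyv⟩ := hv.mem_and_lt hP hy.mem hne hyv
  have hvx' := hy.le_of_inCone v hvP
    (hk.inCone_iff.2 ⟨hyv, (hk.inCone_iff.1 hy.inCone).2.trans hx'v.1⟩)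
  exact hvx'.not_gt hx'v.2

variable (hc : InCone k x x')
include hc

lemma ChainSucc.keptArc : KeptArc P k x x' := by
  have hk := hd.rotate.rotate
  have closest : ∀ w ∈ P, InCone k x w → coneCoord k w ≤ coneCoord k x' := by
    intro w hw hxw
    by_contra! hlt
    obtain ⟨hi, hj⟩ := hk.inCone_iff.1 hxw
    exact (h.gap_empty hP hd hw hj hlt).not_gt (h.left.inCone.lt.trans hi)
  exact ⟨⟨⟨h.left.mem, hc, closest⟩, h.right.mem⟩,
    .inl ⟨j, hd.ne₂₃, fun y hy => h.le_of_arc hP hd hv hy⟩⟩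

lemma ChainSucc.not_arc_left : ¬ Arc P j y x := by
  intro hy
  have hj := hd.rotate
  obtain ⟨hyk, hyi⟩ := hj.inCone_iff.1 hy.inCone
  have hxv := hd.inCone_iff.1 h.left.inCone
  have hx'x := (hd.rotate.rotate.inCone_iff.1 hc).1
  rcases le_or_gt (coneCoord i y) (coneCoord i v) with hyv | hyv
  · have hne : y ≠ v := by
      rintro rfl
      exact lt_asymm hyk hxv.2
    obtain ⟨hvP, hyv⟩ := hv.mem_and_lt hP hy.mem hne hyv
    have hvx := hy.le_of_inCone v hvP (hj.inCone_iff.2 ⟨hyk.trans hxv.2, hyv⟩)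
    exact hvx.not_gt hxv.1
  · have hle : coneCoord k y ≤ coneCoord k x' := by
      by_contra! hlt
      exact (h.gap_empty hP hd hy.mem hy.inCone.lt hlt).not_gt hyv
    have hne : y ≠ x' := by
      rintro rfl
      exact lt_asymm hyi hx'x
    have hlt := lt_of_le_of_ne hle (hP.coneCoord_ne hy.mem h.right.mem hne k)
    have hx'x' := hy.le_of_inCone x' h.right.mem (hj.inCone_iff.2 ⟨hlt, hyi.trans hx'x⟩)
    exact hx'x'.not_gt h.lt

end InCone

lemma ChainSucc.isNext (hd : Distinct3 i j k) (hv : IsAnchor P i v)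
    (h : ChainSucc P i j v x x') : IsNext (nbhd P x) j k x x' := by
  have hne : x ≠ x' := fun e => h.lt.ne (congrArg _ e)
  rw [hP.isNext_iff]
  rcases lt_or_gt_of_ne (hP.coneCoord_ne h.left.mem h.right.mem hne i) with hi | hi
  · have hc : InCone k x x' := hd.rotate.rotate.inCone_iff.2 ⟨hi, h.lt⟩
    exact .inr ⟨fun z hz => h.not_arc_left hP hd hv hc hz.toArc, h.keptArc hP hd hv hc⟩
  · have hback := h.swap hP hd
    have hc : InCone j x' x := hd.rotate.inCone_iff.2 ⟨hback.lt, hi⟩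
    exact .inl ⟨hback.keptArc hP hd.swap hv hc,
      fun z hz => hback.le_of_arc hP hd.swap hv hz.toArc⟩

lemma not_isNext_of_max (hij : i ≠ j) (hjk : j ≠ k) (hv : ∀ y ∈ P, InCone i y v)
    (hmax : ∀ z, OnChain P i v z → coneCoord j z ≤ coneCoord j x) :
    ¬ IsNext (nbhd P x) j k x y := by
  intro h
  obtain ⟨hy, hlt, -⟩ := h.mem_and_lt hP hjk
  obtain ⟨q, hq, hyq⟩ := exists_onChain_above (v := v) hy (hv y hy).lt fun q hq _ _ => hv q hq
  exact (hmax q hq).not_gt (hlt.trans_le (hyq j hij.symm))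

end GeneralPosition

end Chain

/-! ### Routing algorithms given by a state machine -/

section StateMachine

variable {V σ : Type*} [PseudoMetricSpace V] {G : SimpleGraph V} {F : V × σ → V × σ}
  {ok : σ → Prop} {t x : V} {r : V × σ} {L L' : ℝ}

/-- A message at a given vertex, about to move to the position and state `r` and to proceed by `F`
from there, reaches `t` along edges of `G`, through states that satisfy `ok` and within a total
distance of `L`. Recording the next move instead of the current state lets different states that
lead to the same move share a continuation. -/
inductive ArrivesWithin (G : SimpleGraph V) (F : V × σ → V × σ) (ok : σ → Prop) (t : V) :
    V → V × σ → ℝ → Prop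
  | here {r : V × σ} {L : ℝ} : 0 ≤ L → ArrivesWithin G F ok t t r L
  | move {x : V} {r : V × σ} {L L' : ℝ} : G.Adj x r.1 → ok r.2 →
      ArrivesWithin G F ok t r.1 (F r) L → dist x r.1 + L ≤ L' → ArrivesWithin G F ok t x r L'

lemma ArrivesWithin.mono (h : ArrivesWithin G F ok t x r L) (hL : L ≤ L') :
    ArrivesWithin G F ok t x r L' := by
  cases h with
  | here h => exact .here (h.trans hL)
  | move hadj hok h hle => exact .move hadj hok h (hle.trans hL)

lemma ArrivesWithin.exists_iterate (h : ArrivesWithin G F ok t x r L) {c : V × σ} (hx : c.1 = x)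
    (hr : F c = r) : ∃ n, (F^[n] c).1 = t ∧
      (∀ j < n, G.Adj (F^[j] c).1 (F^[j + 1] c).1 ∧ ok (F^[j + 1] c).2) ∧
      ∑ j ∈ Finset.range n, dist (F^[j] c).1 (F^[j + 1] c).1 ≤ L := by
  induction h generalizing c with
  | here h => exact ⟨0, hx, by simp, by simpa⟩
  | @move x r L L' hadj hok _ hle ih =>
    obtain ⟨n, ht, hn, hsum⟩ := ih rfl rfl
    subst hx hr
    refine ⟨n + 1, ht, fun j hj => ?_, ?_⟩
    · cases j with
      | zero => exact ⟨hadj, hok⟩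
      | succ j => exact hn j (Nat.lt_of_succ_lt_succ hj)
    · rw [Finset.sum_range_succ', add_comm]
      exact (add_le_add_right hsum _).trans hle

/-- The configuration after `c`, when routing to `t` on `G` by the transition function `step` of
neighbourhood, destination, position and state. -/
def advance (G : SimpleGraph Plane) (k : ℕ) (step : Set Plane → Plane → Plane → σ → Plane × σ)
    (t : Plane) (c : Plane × σ) : Plane × σ :=
  step (kNeighborhood G k c.1) t c.1 c.2

/-- The routing algorithm with transition function `step` whose states are stored through `encode`,
which has to be injective in order to be read back. -/
def RoutingAlgorithm.ofStateMachine [Nonempty σ] {k m : ℕ} (encode : σ → Memory m)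
    (step : Set Plane → Plane → Plane → σ → Plane × σ) : RoutingAlgorithm k m where
  step s t N M := (step N t s (Function.invFun encode M)).map id encode

variable [Nonempty σ] {k m : ℕ} {encode : σ → Memory m}
  {step : Set Plane → Plane → Plane → σ → Plane × σ} {q₀ : σ}

lemma RoutingAlgorithm.run_ofStateMachine (hinj : encode.Injective)
    (h₀ : encode q₀ = fun _ => .int 0) (G : SimpleGraph Plane) (s t : Plane) (j : ℕ) :
    (ofStateMachine (k := k) encode step).run G s t j =
      ((advance G k step t)^[j] (s, q₀)).map id encode := by
  induction j with
  | zero => exact congrArg (Prod.mk s) h₀.symm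
  | succ j ih =>
    rw [run, ih, Function.iterate_succ_apply']
    simp only [ofStateMachine, advance, Prod.map_fst, Prod.map_snd, id_eq,
      Function.leftInverse_invFun hinj _]

lemma RoutingAlgorithm.deliversWithin_ofStateMachine {P : Finset Plane} {G : SimpleGraph Plane}
    {s t : Plane} (hinj : encode.Injective) (h₀ : encode q₀ = fun _ => .int 0)
    (hok : ∀ q, ok q → ∀ r, (encode q r).Admissible P) (hq₀ : ok q₀)
    (h : ArrivesWithin G (advance G k step t) ok t s (advance G k step t (s, q₀)) L) :
    (ofStateMachine (k := k) encode step).DeliversWithin P G s t L := by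
  obtain ⟨n, ht, hn, hsum⟩ := h.exists_iterate rfl rfl
  simp only [DeliversWithin, run_ofStateMachine hinj h₀, Prod.map_fst, Prod.map_snd, id_eq]
  refine ⟨n, ht, fun j hj => (hn j hj).1, fun j hj => hok _ ?_, hsum⟩
  cases j with
  | zero => exact hq₀
  | succ j => exact (hn j hj).2

end StateMachine

section Registers

variable {Q ι : Type*} [Fintype Q] [DecidableEq Q] [Fintype ι]

/-- The memory contents for a control state in a finite set `Q` and optional points. The control
state is stored in unary, since each memory unit must hold an integer below the number of vertices,
and the initial control state `q₀` is stored as zeros. -/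
def encodeRegisters (q₀ : Q) (c : Q × (ι → Option Plane)) : Memory (Fintype.card (Q ⊕ ι)) :=
  fun r => match (Fintype.equivFin (Q ⊕ ι)).symm r with
    | .inl q => .int (if q = c.1 ∧ q ≠ q₀ then 1 else 0)
    | .inr b => ((c.2 b).map .point).getD (.int 0)

lemma encodeRegisters_injective (q₀ : Q) : (encodeRegisters (ι := ι) q₀).Injective := by
  rintro ⟨q, p⟩ ⟨q', p'⟩ h
  have hunit (u : Q ⊕ ι) := congrFun h (Fintype.equivFin _ u)
  simp only [encodeRegisters, Equiv.symm_apply_apply] at hunit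
  have hq : q = q' := by
    by_contra hne
    by_cases hq : q = q₀
    · simpa [← hq, hne, Ne.symm hne] using hunit (.inl q')
    · simpa [hq, hne] using hunit (.inl q)
  have hp : p = p' := by
    funext b
    have hb := hunit (.inr b)
    cases hpb : p b <;> cases hpb' : p' b <;> simp_all
  rw [hq, hp]

lemma encodeRegisters_none (q₀ : Q) :
    encodeRegisters (ι := ι) q₀ (q₀, fun _ => none) = fun _ => .int 0 := by
  funext r
  obtain ⟨q | b, rfl⟩ := (Fintype.equivFin (Q ⊕ ι)).surjective r <;> simp [encodeRegisters]

lemma encodeRegisters_admissible {P : Finset Plane} (hP : 1 < P.card) {q₀ : Q}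
    {c : Q × (ι → Option Plane)} (hc : ∀ b, ∀ p ∈ c.2 b, p ∈ P) (r) :
    (encodeRegisters q₀ c r).Admissible P := by
  obtain ⟨q | b, rfl⟩ := (Fintype.equivFin (Q ⊕ ι)).surjective r <;>
    simp only [encodeRegisters, Equiv.symm_apply_apply]
  · simp only [MemoryUnit.Admissible]
    split_ifs <;> omega
  · cases hb : c.2 b with
    | none => exact zero_lt_one.trans hP
    | some p => exact hc b p hb

end Registers

/-! ### The routing algorithm -/

open Classical in
/-- An element that satisfies `p`, if there is one. -/
def pick {α : Type*} (p : α → Prop) : Option α :=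
  if h : ∃ y, p y then some h.choose else none

lemma pick_eq_none_iff {α : Type*} {p : α → Prop} : pick p = none ↔ ∀ y, ¬ p y := by
  simp [pick]

lemma of_pick_eq_some {α : Type*} {p : α → Prop} {y : α} (h : pick p = some y) : p y := by
  obtain ⟨hp, he⟩ := Option.dite_none_right_eq_some.1 h
  exact Option.some.inj he ▸ hp.choose_spec

lemma pick_eq_some {α : Type*} {p : α → Prop} {y : α} (h : p y) (hunique : ∀ z, p z → z = y) :
    pick p = some y := by
  cases hpick : pick p with
  | none => exact absurd h (pick_eq_none_iff.1 hpick y)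
  | some z => rw [hunique z (of_pick_eq_some hpick)]

/-- The control state of the routing algorithm: at rest, searching along a chain, returning to the
origin of a failed search, or walking along a chain past the destination. A flag `some j` records
that the side region in the cone `C_j` of the current vertex is known to be empty. -/
inductive RouteState : Type
  | idle (flag : Option (Fin 3))
  | search (i j k : Fin 3) (flag : Option (Fin 3)) (origin : Plane) (other : Option Plane)
  | back (i : Fin 3) (origin : Plane)
  | walk (j k : Fin 3) (flag : Option (Fin 3))

/-- The content of a state, split into finite control and two optional points for the memory. -/
def RouteState.registers :
    RouteState → (Fin 4 × Fin 3 × Fin 3 × Fin 3 × Option (Fin 3)) × (Bool → Option Plane)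
  | .idle f => ((0, 0, 0, 0, f), fun _ => none)
  | .search i j k f s o => ((1, i, j, k, f), fun b => bif b then some s else o)
  | .back i s => ((2, i, 0, 0, none), fun b => bif b then some s else none)
  | .walk j k f => ((3, 0, j, k, f), fun _ => none)

/-- All points stored in a state are vertices. -/
def RouteState.PointsIn (P : Finset Plane) (q : RouteState) : Prop :=
  ∀ b, ∀ p ∈ q.registers.2 b, p ∈ P

/-- The index different from two distinct indices. -/
def third (i j : Fin 3) : Fin 3 := -(i + j)

/-- The signed position of `z` relative to `s` on a chain, where the `j`-th coordinate grows and the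
`k`-th one decreases. -/
def offset (j k : Fin 3) (s z : Plane) : ℝ :=
  (coneCoord j z - coneCoord k z) - (coneCoord j s - coneCoord k s)

/-- The vertex that follows `x` on a chain according to the local rule. -/
def nextVertex (N : Set Plane) (j k : Fin 3) (x : Plane) : Option Plane := pick (IsNext N j k x)

/-- The next vertex, unless it is farther than `B` from the origin `s` of the search. -/
def boundedNext (N : Set Plane) (j k : Fin 3) (s : Plane) (B : ℝ) (x : Plane) : Option Plane :=
  (nextVertex N j k x).filter fun y => offset j k s y ≤ B

/-- The next vertex in the direction from `x` to `s` on a chain for the cone `C_i`. -/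
def nextToward (N : Set Plane) (i : Fin 3) (s x : Plane) : Option Plane :=
  if coneCoord (i + 1) x < coneCoord (i + 1) s then nextVertex N (i + 1) (i + 2) x
  else nextVertex N (i + 2) (i + 1) x

open Classical in
/-- The flag after the search from `s` in the cone `C_i` has reached `v`. If `t` is in that cone,
then the empty triangle spanned by `s` and `v` covers one of the side regions at `v`. -/
def newFlag (i : Fin 3) (f : Option (Fin 3)) (s t v : Plane) : Option (Fin 3) :=
  if InCone i s t then (pick fun k => InCone k t v).map (third i) else f

open Classical in
/-- Return along the chain to the origin `s` of a search; once at `s`, make the move `fb`. -/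
def backStep (fb : Plane × RouteState) (N : Set Plane) (i : Fin 3) (s x : Plane) :
    Plane × RouteState :=
  if x = s then fb else ((nextToward N i s x).getD x, .back i s)

open Classical in
/-- One step of the doubling search from `s` for the closest vertex in the cone `C_i` of `s`: walk
along its chain, turning whenever the distance from `s` would exceed twice the one reached on the
other side, until the arc to that vertex is visible. Here `o` is the next vertex on the other side.
The search is given up at distance `2 * (s_i - t_i)`, and when a vertex closer than `t` is found. -/
def searchStep (fb : Plane × RouteState) (N : Set Plane) (t : Plane) (i j k : Fin 3)
    (f : Option (Fin 3)) (s : Plane) (o : Option Plane) (x : Plane) : Plane × RouteState :=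
  match pick fun y => y ∈ N ∧ InCone i x y with
  | some v =>
    if coneCoord i t ≤ coneCoord i v then (v, .idle (newFlag i f s t v)) else backStep fb N i s x
  | none =>
    let next := boundedNext N j k s (2 * (coneCoord i s - coneCoord i t)) x
    match next.filter fun y => ∀ a ∈ o, offset j k s y ≤ 2 * offset k j s a with
    | some y => (y, .search i j k f s o)
    | none =>
      if o = none then backStep fb N i s x
      else ((nextVertex N k j x).getD x, .search i k j f s next)

/-- The first step of a search. -/
def startSearch (fb : Plane × RouteState) (N : Set Plane) (t : Plane) (i : Fin 3)
    (f : Option (Fin 3)) (s : Plane) : Plane × RouteState :=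
  searchStep fb N t i (i + 1) (i + 2) f s
    (boundedNext N (i + 2) (i + 1) s (2 * (coneCoord i s - coneCoord i t)) s) s

/-- A direct move from `s` towards a `t` with `s` in the cone `C_i` of `t`, where the `j`-th
coordinate is the one to be kept large: to the neighbour with the largest `k`-th coordinate, if it
sees `s` in the same cone as `t` does, or else to the closest neighbour if there are neighbours on
both sides of `t`, in order to walk along the chain of `s` from there. -/
def descend (N : Set Plane) (t : Plane) (i j k : Fin 3) (f : Option (Fin 3)) (s : Plane) :
    Option (Plane × RouteState) :=
  ((pick fun y => (y ∈ N ∧ InCone i y s) ∧ InClosedCone i t y ∧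
      ∀ z ∈ N, InCone i z s → coneCoord k z ≤ coneCoord k y).map (·, .idle f)).or
    ((pick fun c => (c ∈ N ∧ InCone i c s) ∧
      (∀ z ∈ N, InCone i z s → coneCoord i c ≤ coneCoord i z) ∧
      (∃ z ∈ N, InCone i z s ∧ coneCoord j z < coneCoord j t) ∧
      ∃ z ∈ N, InCone i z s ∧ coneCoord j t ≤ coneCoord j z).map (·, .walk j k f))

/-- A step towards `t` if `s` is in the cone `C_i` of `t` and the side region in `C_j` is empty. -/
def flagStep (N : Set Plane) (t : Plane) (i j k : Fin 3) (s : Plane) : Plane × RouteState :=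
  (descend N t i j k (some j) s).getD (startSearch (s, .idle none) N t k (some j) s)

/-- The direction of the smaller side region at `s`. -/
def smallSide (i : Fin 3) (t s : Plane) : Fin 3 :=
  if coneCoord (i + 1) s - coneCoord (i + 1) t ≤ coneCoord (i + 2) s - coneCoord (i + 2) t then
    i + 1 else i + 2

/-- A step towards `t` if `s` is in the cone `C_i` of `t` and no side region is known to be empty:
failing a direct move, search the cone `C_j` and move as with an empty side region afterwards. -/
def unflaggedStep (N : Set Plane) (t : Plane) (i j k : Fin 3) (s : Plane) : Plane × RouteState :=
  (descend N t i j k none s).getD (startSearch (flagStep N t i j k s) N t j none s)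

/-- A routing decision at rest. -/
def idleStep (N : Set Plane) (t s : Plane) (f : Option (Fin 3)) : Plane × RouteState :=
  match pick (InCone · s t), pick (InCone · t s) with
  | some i, _ => startSearch (s, .idle none) N t i none s
  | none, some i =>
    match f with
    | some j => flagStep N t i j (third i j) s
    | none => unflaggedStep N t i (smallSide i t s) (third i (smallSide i t s)) s
  | none, none => (s, .idle none)

/-- One step of the walk along a chain to the last vertex before the line through `t` on which the
`j`-th coordinate is constant. -/
def walkStep (N : Set Plane) (t : Plane) (j k : Fin 3) (f : Option (Fin 3)) (x : Plane) :
    Plane × RouteState :=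
  if coneCoord j x < coneCoord j t then ((nextVertex N j k x).getD x, .walk j k f)
  else match (nextVertex N k j x).filter fun y => coneCoord j t ≤ coneCoord j y with
    | some y => (y, .walk j k f)
    | none => idleStep N t x f

/-- The transition function of the routing algorithm. -/
def routeStep (N : Set Plane) (t x : Plane) : RouteState → Plane × RouteState
  | .idle f => idleStep N t x f
  | .search i j k f s o => searchStep (idleStep N t x (some i)) N t i j k f s o x
  | .back i s => backStep (idleStep N t x (some i)) N i s x
  | .walk j k f => walkStep N t j k f x

lemma RouteState.registers_injective : registers.Injective := by
  intro q q' h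
  cases q <;> cases q' <;>
    simp_all [registers, funext_iff]

lemma RouteState.pointsIn_search {P : Finset Plane} {i j k : Fin 3} {f : Option (Fin 3)} {s : Plane}
    {o : Option Plane} (hs : s ∈ P) (ho : ∀ a ∈ o, a ∈ P) :
    (search i j k f s o).PointsIn P := by
  rintro (_ | _) p hp
  exacts [ho p hp, Option.mem_some_iff.1 hp ▸ hs]

lemma RouteState.pointsIn_back {P : Finset Plane} {i : Fin 3} {s : Plane} (hs : s ∈ P) :
    (back i s).PointsIn P := by
  rintro (_ | _) p hp
  exacts [absurd hp (Option.not_mem_none p), Option.mem_some_iff.1 hp ▸ hs]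

lemma RouteState.pointsIn_idle {P : Finset Plane} {f : Option (Fin 3)} : (idle f).PointsIn P :=
  fun _ p hp => absurd hp (Option.not_mem_none p)

lemma RouteState.pointsIn_walk {P : Finset Plane} {j k : Fin 3} {f : Option (Fin 3)} :
    (walk j k f).PointsIn P :=
  fun _ p hp => absurd hp (Option.not_mem_none p)

/-! ### Positions on a chain -/

lemma offset_self (j k : Fin 3) (s : Plane) : offset j k s s = 0 := sub_self _

lemma offset_swap (j k : Fin 3) (s z : Plane) : offset k j s z = -offset j k s z := by
  simp only [offset]
  ring

lemma abs_offset_comm (j k : Fin 3) (s z : Plane) : |offset j k s z| = |offset k j s z| := by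
  rw [offset_swap, abs_neg]

section GeneralPosition

variable {P : Finset Plane} (hP : GeneralPosition P) {i j k : Fin 3} (hd : Distinct3 i j k)
  {v x x' y z : Plane}
include hP hd

lemma OnChain.offset_lt_iff (hx : OnChain P i v x) (s : Plane) (hy : OnChain P i v y) :
    offset j k s x < offset j k s y ↔ coneCoord j x < coneCoord j y := by
  have hlt := hx.lt_iff hP hd hy
  have hle := hy.le_iff hP hd hx
  constructor
  · intro h
    by_contra! hyx
    have hxy := hle.1 hyx
    simp only [offset] at h
    linarith
  · intro h
    have hyx := hlt.1 h
    simp only [offset]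
    linarith

lemma OnChain.offset_le_iff (hx : OnChain P i v x) (s : Plane) (hy : OnChain P i v y) :
    offset j k s x ≤ offset j k s y ↔ coneCoord j x ≤ coneCoord j y := by
  rw [← not_lt, ← not_lt, hy.offset_lt_iff hP hd s hx]

lemma OnChain.eq_of_offset_eq {s : Plane} (hx : OnChain P i v x) (hy : OnChain P i v y)
    (h : offset j k s x = offset j k s y) : x = y := by
  by_contra hne
  exact hP.coneCoord_ne hx.mem hy.mem hne j <| le_antisymm
    ((hx.offset_le_iff hP hd s hy).1 h.le) ((hy.offset_le_iff hP hd s hx).1 h.ge)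

lemma OnChain.dist_le_offset_sub (hx : OnChain P i v x) (hy : OnChain P i v y)
    (h : coneCoord j x ≤ coneCoord j y) (s : Plane) :
    dist x y ≤ offset j k s y - offset j k s x := by
  have hk := (hx.le_iff hP hd hy).1 h
  refine (dist_le_add hd.ne₂₃ x y).trans_eq ?_
  rw [abs_of_nonneg (sub_nonneg.2 h), abs_of_nonpos (sub_nonpos.2 hk), offset, offset]
  ring

lemma ChainSucc.offset_le (h : ChainSucc P i j v x x') (s : Plane) (hz : OnChain P i v z)
    (hlt : offset j k s x < offset j k s z) : offset j k s x' ≤ offset j k s z :=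
  (h.right.offset_le_iff hP hd s hz).2
    (h.le_of_lt z hz ((h.left.offset_lt_iff hP hd s hz).1 hlt))

lemma ChainSucc.offset_lt (h : ChainSucc P i j v x x') (s : Plane) :
    offset j k s x < offset j k s x' :=
  (h.left.offset_lt_iff hP hd s h.right).2 h.lt

variable (hv : IsAnchor P i v)
include hv

lemma ChainSucc.nextVertex_eq (h : ChainSucc P i j v x x') :
    nextVertex (nbhd P x) j k x = some x' :=
  pick_eq_some (h.isNext hP hd hv) fun _ hz => hz.unique hP (h.isNext hP hd hv)

lemma ChainSucc.adj (h : ChainSucc P i j v x x') : (GTwelve P).Adj x x' :=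
  (h.isNext hP hd hv).adj hP

lemma OnChain.mem_nextVertex_iff (hx : OnChain P i v x) (hxv : ¬ KeptArc P i x v) :
    y ∈ nextVertex (nbhd P x) j k x ↔ ChainSucc P i j v x y := by
  refine ⟨fun hy => ?_, fun h => h.nextVertex_eq hP hd hv⟩
  by_cases hz : ∃ z, OnChain P i v z ∧ coneCoord j x < coneCoord j z
  · obtain ⟨z, hz, hlt⟩ := hz
    obtain ⟨x', hx'⟩ := hx.exists_succ hz hlt
    rw [hx'.nextVertex_eq hP hd hv, Option.mem_some_iff] at hy
    exact hy ▸ hx'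
  · push Not at hz
    rcases hv with hv | hv
    · exact absurd ⟨⟨hx, hv⟩, .inl ⟨j, hd.ne₁₂.symm, fun y hy => hz y hy.toOnChain⟩⟩ hxv
    · have hnone := pick_eq_none_iff.2 fun y => not_isNext_of_max hP hd.ne₁₂ hd.ne₂₃ hv hz (y := y)
      rw [nextVertex, hnone] at hy
      exact absurd hy (Option.not_mem_none y)

lemma OnChain.mem_boundedNext_iff (hx : OnChain P i v x) (hxv : ¬ KeptArc P i x v) {s : Plane}
    {B : ℝ} : y ∈ boundedNext (nbhd P x) j k s B x ↔
      ChainSucc P i j v x y ∧ offset j k s y ≤ B := by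
  rw [← hx.mem_nextVertex_iff hP hd hv hxv, boundedNext, Option.mem_def, Option.mem_def,
    Option.filter_eq_some_iff, decide_eq_true_iff]

lemma OnChain.lt_offset_of_boundedNext_eq_none (hx : OnChain P i v x) (hxv : ¬ KeptArc P i x v)
    {s : Plane} {B : ℝ} (h : boundedNext (nbhd P x) j k s B x = none) (hz : OnChain P i v z)
    (hlt : offset j k s x < offset j k s z) : B < offset j k s z := by
  obtain ⟨x', hx'⟩ := hx.exists_succ hz ((hx.offset_lt_iff hP hd s hz).1 hlt)
  have hle := hx'.offset_le hP hd s hz hlt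
  by_contra! hzB
  have hmem := (hx.mem_boundedNext_iff hP hd hv hxv).2 ⟨hx', hle.trans hzB⟩
  rw [h] at hmem
  exact Option.not_mem_none _ hmem

end GeneralPosition

/-! ### The doubling search -/

/-- A message that is at `x` and makes the move `r` of the routing algorithm arrives at `t` within
distance `L`. -/
abbrev Arrives (P : Finset Plane) (t x : Plane) (r : Plane × RouteState) (L : ℝ) : Prop :=
  ArrivesWithin (GTwelve P) (advance (GTwelve P) 1 routeStep t) (RouteState.PointsIn P) t x r L

/-- The knowledge about the chain of `v` on the side of growing `k`-th coordinate while the search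
from `s` is at `x`, where `a` is the next unvisited vertex on that side and `W` bounds the distance
travelled. -/
structure Frontier (P : Finset Plane) (i j k : Fin 3) (v s : Plane) (B : ℝ) (x a : Plane)
    (W : ℝ) : Prop where
  onChain : OnChain P i v a
  pos : 0 < offset k j s a
  le_budget : offset k j s a ≤ B
  le_of_keptArc : ∀ z, KeptArc P i z v → 0 < offset k j s z → offset k j s a ≤ offset k j s z
  lt : -offset k j s a < offset j k s x
  le_two_mul : offset j k s x ≤ 2 * offset k j s a
  travelled_le : W ≤ offset j k s x + 4 * offset k j s a

/-- The invariant of the doubling search from `s` on the chain of `v` when it is at `x`, moves in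
the direction of growing `j`-th coordinate, and has travelled at most `W`. The next vertex on the
other side is `o`, and the search is confined to vertices at offset at most `B`. -/
structure SearchInv (P : Finset Plane) (i j k : Fin 3) (v s : Plane) (B : ℝ) (x : Plane)
    (o : Option Plane) (W : ℝ) : Prop where
  onChain : OnChain P i v x
  ahead_le : ∀ z, KeptArc P i z v → 0 < offset j k s z → offset j k s x ≤ offset j k s z
  ahead_travelled_le : ∀ z, KeptArc P i z v → 0 < offset j k s z →
    W ≤ offset j k s x + 8 * offset j k s z
  frontier : ∀ a ∈ o, Frontier P i j k v s B x a W
  behind_of_none : o = none → ∀ z, KeptArc P i z v → 0 < offset k j s z → B < offset k j s z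
  le_budget : offset j k s x ≤ B
  neg_budget_le : -B ≤ offset j k s x
  travelled_le : W ≤ offset j k s x + 8 * B

section GeneralPosition

variable {P : Finset Plane} (hP : GeneralPosition P) {i j k : Fin 3} {v s t x x' y z a : Plane}
  {B W R L : ℝ} {o : Option Plane} {f : Option (Fin 3)} {fb : Plane × RouteState}
include hP

lemma KeptArc.adj (h : KeptArc P i x v) : (GTwelve P).Adj x v := hP.gTwelve_adj_iff.2 ⟨i, .inl h⟩

lemma searchStep_of_keptArc (h : KeptArc P i x v) :
    searchStep fb (nbhd P x) t i j k f s o x = if coneCoord i t ≤ coneCoord i v then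
      (v, .idle (newFlag i f s t v)) else backStep fb (nbhd P x) i s x := by
  have hpick : pick (fun y => y ∈ nbhd P x ∧ InCone i x y) = some v :=
    pick_eq_some (hP.mem_nbhd_and_inCone_iff.2 h)
      fun y hy => (hP.mem_nbhd_and_inCone_iff.1 hy).head_unique hP h.toArc
  simp only [searchStep, hpick]

lemma OnChain.eq_of_keptArc (hv : IsAnchor P i v) (hx : OnChain P i v x) (h : KeptArc P i x y) :
    y = v := by
  rcases hv with hv | hv
  · exact h.head_unique hP (hx.arc hv)
  · exact absurd (hx.le_of_inCone y h.mem_head h.inCone) (hv y h.mem_head).lt.not_ge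

section Search

variable (hd : Distinct3 i j k)
include hd

lemma SearchInv.ahead_lt (hI : SearchInv P i j k v s B x o W) (hxv : ¬ KeptArc P i x v)
    (hz : KeptArc P i z v) (hpos : 0 < offset j k s z) : offset j k s x < offset j k s z :=
  lt_of_le_of_ne (hI.ahead_le z hz hpos) fun e =>
    hxv (hI.onChain.eq_of_offset_eq hP hd hz.toOnChain e ▸ hz)

lemma SearchInv.advance (hI : SearchInv P i j k v s B x o W) (hxv : ¬ KeptArc P i x v)
    (h : ChainSucc P i j v x x') (hle : offset j k s x' ≤ B)
    (htwo : ∀ a ∈ o, offset j k s x' ≤ 2 * offset k j s a) :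
    SearchInv P i j k v s B x' o (W + dist x x') := by
  have hlt := h.offset_lt hP hd s
  have hdist := h.left.dist_le_offset_sub hP hd h.right h.lt.le s
  refine ⟨h.right, fun z hz hpos => ?_, fun z hz hpos => ?_, fun a ha => ?_, hI.behind_of_none, hle,
    hI.neg_budget_le.trans hlt.le, ?_⟩
  · exact h.offset_le hP hd s hz.toOnChain (hI.ahead_lt hP hd hxv hz hpos)
  · linarith [hI.ahead_travelled_le z hz hpos]
  · have ha' := hI.frontier a ha
    exact { ha' with
      lt := ha'.lt.trans hlt
      le_two_mul := htwo a ha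
      travelled_le := by linarith [ha'.travelled_le] }
  · linarith [hI.travelled_le]

/-- The path to `x` has led to the other side and back, with turning points in geometric
progression: hence the factors 4 and 8 in the invariant. -/
lemma SearchInv.turn (hv : IsAnchor P i v) (hs : OnChain P i v s) (hB : 0 ≤ B)
    (hI : SearchInv P i j k v s B x o W) (hxv : ¬ KeptArc P i x v) (ha : a ∈ o)
    (hfar : ∀ y ∈ boundedNext (nbhd P x) j k s B x, 2 * offset k j s a < offset j k s y) :
    ∃ y, ChainSucc P i k v x y ∧
      SearchInv P i k j v s B y (boundedNext (nbhd P x) j k s B x) (W + dist x y) := by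
  have hF := hI.frontier a ha
  have hmem {y} := hI.onChain.mem_boundedNext_iff hP hd hv hxv (s := s) (B := B) (y := y)
  have hnonneg : 0 ≤ offset j k s x := by
    by_contra! hneg
    rw [← offset_self j k s] at hneg
    obtain ⟨y, hy⟩ := hI.onChain.exists_succ hs ((hI.onChain.offset_lt_iff hP hd s hs).1 hneg)
    have hys := hy.offset_le hP hd s hs hneg
    rw [offset_self] at hys
    linarith [hfar y (hmem.2 ⟨hy, hys.trans hB⟩), hF.pos]
  have hxa : offset k j s x < offset k j s a := by linarith [offset_swap j k s x, hF.pos]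
  obtain ⟨y, hy⟩ := hI.onChain.exists_succ hF.onChain
    ((hI.onChain.offset_lt_iff hP hd.swap s hF.onChain).1 hxa)
  have hya := hy.offset_le hP hd.swap s hF.onChain hxa
  have hyx := hy.offset_lt hP hd.swap s
  have hdist := hy.left.dist_le_offset_sub hP hd.swap hy.right hy.lt.le s
  have hx := offset_swap j k s x
  have hlt := hF.travelled_le
  have htwo := hF.le_two_mul
  have haB := hF.le_budget
  refine ⟨y, hy, hy.right, fun z hz hpos => hya.trans (hF.le_of_keptArc z hz hpos),
    fun z hz hpos => ?_, fun n hn => ?_, fun hnone z hz hpos => ?_, hya.trans haB, ?_, ?_⟩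
  · linarith [hF.le_of_keptArc z hz hpos]
  · obtain ⟨hn', hnB⟩ := hmem.1 hn
    have hxn := hn'.offset_lt hP hd s
    have hfar := hfar n hn
    exact ⟨hn'.right, hnonneg.trans_lt hxn, hnB,
      fun z hz hpos => hn'.offset_le hP hd s hz.toOnChain (hI.ahead_lt hP hd hxv hz hpos),
      by linarith, by linarith, by linarith⟩
  · exact hI.onChain.lt_offset_of_boundedNext_eq_none hP hd hv hxv hnone hz.toOnChain
      (hI.ahead_lt hP hd hxv hz hpos)
  · linarith [hI.le_budget]
  · linarith

lemma SearchInv.lt_abs_offset (hs : OnChain P i v s) (hsv : ¬ KeptArc P i s v)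
    (hv : IsAnchor P i v) (hI : SearchInv P i j k v s B x none W) (hxv : ¬ KeptArc P i x v)
    (hnone : boundedNext (nbhd P x) j k s B x = none) (hz : KeptArc P i z v) :
    B < |offset j k s z| := by
  rcases lt_trichotomy (offset j k s z) 0 with hneg | h0 | hpos
  · rw [abs_offset_comm]
    exact (hI.behind_of_none rfl z hz (by linarith [offset_swap j k s z])).trans_le (le_abs_self _)
  · rw [← offset_self j k s] at h0
    exact absurd (hz.toOnChain.eq_of_offset_eq hP hd hs h0 ▸ hz) hsv
  · exact (hI.onChain.lt_offset_of_boundedNext_eq_none hP hd hv hxv hnone hz.toOnChain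
      (hI.ahead_lt hP hd hxv hz hpos)).trans_le (le_abs_self _)

lemma SearchInv.start (hv : IsAnchor P i v) (hs : OnChain P i v s) (hsv : ¬ KeptArc P i s v)
    (hB : 0 ≤ B) : SearchInv P i j k v s B s (boundedNext (nbhd P s) k j s B s) 0 := by
  have h0 := offset_self j k s
  have h0' := offset_self k j s
  refine ⟨hs, fun z _ hpos => h0.trans_le hpos.le, fun z _ hpos => by linarith, fun a ha => ?_,
    fun hnone z hz hpos => ?_, by linarith, by linarith, by linarith⟩
  · obtain ⟨ha', haB⟩ := (hs.mem_boundedNext_iff hP hd.swap hv hsv).1 ha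
    have hpos := ha'.offset_lt hP hd.swap s
    exact ⟨ha'.right, by linarith, haB,
      fun z hz hpos => ha'.offset_le hP hd.swap s hz.toOnChain (by linarith),
      by linarith, by linarith, by linarith⟩
  · exact hs.lt_offset_of_boundedNext_eq_none hP hd.swap hv hsv hnone hz.toOnChain (by linarith)

lemma SearchInv.step (hv : IsAnchor P i v) (hs : OnChain P i v s) (hsv : ¬ KeptArc P i s v)
    (hB : B = 2 * (coneCoord i s - coneCoord i t)) (hB₀ : 0 ≤ B)
    (hI : SearchInv P i j k v s B x o W) (hxv : ¬ KeptArc P i x v) :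
    (∃ j' k' y o', Distinct3 i j' k' ∧ (GTwelve P).Adj x y ∧
      SearchInv P i j' k' v s B y o' (W + dist x y) ∧
      searchStep fb (nbhd P x) t i j k f s o x = (y, .search i j' k' f s o')) ∨
    searchStep fb (nbhd P x) t i j k f s o x = backStep fb (nbhd P x) i s x ∧
      ∀ z, KeptArc P i z v → B < |offset j k s z| := by
  have hpick : pick (fun y => y ∈ nbhd P x ∧ InCone i x y) = none := by
    refine pick_eq_none_iff.2 fun y hy => hxv ?_
    have hxy := hP.mem_nbhd_and_inCone_iff.1 hy
    exact hI.onChain.eq_of_keptArc hP hv hxy ▸ hxy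
  simp only [searchStep, hpick, ← hB]
  split
  case h_1 y hy =>
    rw [Option.filter_eq_some_iff, decide_eq_true_iff] at hy
    obtain ⟨hxy, hle⟩ := (hI.onChain.mem_boundedNext_iff hP hd hv hxv).1 hy.1
    exact .inl ⟨j, k, y, o, hd, hxy.adj hP hd hv, hI.advance hP hd hxv hxy hle hy.2, rfl⟩
  case h_2 hfar =>
    simp only [Option.filter_eq_none_iff, decide_eq_true_iff] at hfar
    cases o with
    | none =>
      refine .inr ⟨if_pos rfl, fun z hz => hI.lt_abs_offset hP hd hs hsv hv hxv ?_ hz⟩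
      exact Option.eq_none_iff_forall_not_mem.2 fun y hy => hfar y hy (by simp)
    | some a =>
      obtain ⟨y, hxy, hI'⟩ := hI.turn hP hd hv hs hB₀ hxv rfl
        fun y hy => by simpa using hfar y hy
      refine .inl ⟨k, j, y, _, hd.swap, hxy.adj hP hd.swap hv, hI', ?_⟩
      rw [if_neg (Option.some_ne_none a), hxy.nextVertex_eq hP hd.swap hv, Option.getD_some]

end Search

end GeneralPosition

lemma exists_pos_forall_le_dist {X : Type*} [MetricSpace X] (S : Finset X) :
    ∃ δ > 0, ∀ x ∈ S, ∀ y ∈ S, x ≠ y → δ ≤ dist x y := by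
  by_cases hS : (S : Set X).Nontrivial
  · exact ⟨(S : Set X).infsep, S.finite_toSet.infsep_pos_iff_nontrivial.2 hS,
      fun x hx y hy hne => Set.infsep_le_dist_of_mem hx hy hne⟩
  · exact ⟨1, one_pos, fun x hx y hy hne => absurd ⟨x, hx, y, hy, hne⟩ hS⟩

lemma induction_on_lt {X : Type*} {S : Finset X} (g : X → ℝ) {p : X → Prop}
    (h : ∀ x ∈ S, (∀ y ∈ S, g y < g x → p y) → p x) {x : X} (hx : x ∈ S) : p x :=
  (S.finite_toSet.wellFoundedOn (r := g ⁻¹'o (· < ·))).induction hx h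

lemma Distinct3.abs_offset_eq {i j k j' k' : Fin 3} (hd : Distinct3 i j k)
    (hd' : Distinct3 i j' k') (s z : Plane) : |offset j k s z| = |offset j' k' s z| := by
  obtain ⟨hij, hik, hjk⟩ := hd
  obtain ⟨hij', hik', hjk'⟩ := hd'
  obtain ⟨rfl, rfl⟩ | ⟨rfl, rfl⟩ : (j = j' ∧ k = k') ∨ (j = k' ∧ k = j') := by omega
  exacts [rfl, abs_offset_comm _ _ _ _]

section GeneralPosition

variable {P : Finset Plane} (hP : GeneralPosition P) {i j k : Fin 3} {v s t x y m c : Plane}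
  {B W R L : ℝ} {o : Option Plane} {f : Option (Fin 3)} {fb : Plane × RouteState}

lemma Arc.exists_forall_le (h : Arc P i s v) (g : Plane → ℝ) :
    ∃ c, Arc P i c v ∧ ∀ y, Arc P i y v → g y ≤ g c := by
  classical
  obtain ⟨c, hc, hmax⟩ := (P.filter fun y => Arc P i y v).exists_max_image g
    ⟨s, Finset.mem_filter.2 ⟨h.mem, h⟩⟩
  exact ⟨c, (Finset.mem_filter.1 hc).2, fun y hy => hmax y (Finset.mem_filter.2 ⟨hy.mem, hy⟩)⟩

lemma Arc.exists_closest (h : Arc P i s v) :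
    ∃ c, KeptArc P i c v ∧ ∀ y, Arc P i y v → coneCoord i c ≤ coneCoord i y := by
  obtain ⟨c, hc, hmax⟩ := h.exists_forall_le fun y => -coneCoord i y
  have hmin : ∀ y, Arc P i y v → coneCoord i c ≤ coneCoord i y :=
    fun y hy => neg_le_neg_iff.1 (hmax y hy)
  exact ⟨c, ⟨hc, .inr hmin⟩, hmin⟩

lemma Arc.exists_extreme (h : Arc P i s v) (hij : i ≠ j) :
    ∃ c, KeptArc P i c v ∧ ∀ y, Arc P i y v → coneCoord j y ≤ coneCoord j c := by
  obtain ⟨c, hc, hmax⟩ := h.exists_forall_le (coneCoord j)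
  exact ⟨c, ⟨hc, .inl ⟨j, hij.symm, hmax⟩⟩, hmax⟩

include hP

section Search

/-- The factor 9 is the cost of the doubling search relative to the distance along the chain. -/
lemma Arc.offset_le_and_detour_le (hd : Distinct3 i j k) (hs : Arc P i s v) (hc : Arc P i c v)
    (hle : coneCoord i c ≤ coneCoord i s) :
    |offset j k s c| ≤ 2 * (coneCoord i s - coneCoord i v) ∧
      9 * |offset j k s c| + dist c v ≤ 19 * dist s v := by
  wlog hcs : coneCoord j c ≤ coneCoord j s generalizing j k
  · rw [abs_offset_comm]
    exact this hd.swap ((hc.le_iff hP hd.swap hs.toOnChain).2 (le_of_not_ge hcs))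
  have hk := (hc.le_iff hP hd hs.toOnChain).1 hcs
  obtain ⟨hcj, hck⟩ := hd.inCone_iff.1 hc.inCone
  have hsj := (hd.inCone_iff.1 hs.inCone).1
  have hcv := dist_le_add hd.ne₂₃ c v
  have hsv := add_half_le_dist hd.ne₂₃.symm s v
  have hs0 := hd.sum_eq_zero s
  have hc0 := hd.sum_eq_zero c
  have hv0 := hd.sum_eq_zero v
  rw [abs_of_pos (sub_pos.2 hcj), abs_of_pos (sub_pos.2 hck)] at hcv
  have habs : |offset j k s c| =
      (coneCoord j s - coneCoord j c) + (coneCoord k c - coneCoord k s) := by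
    rw [abs_of_nonpos (by simp only [offset]; linarith), offset]
    ring
  constructor <;> linarith

variable (hd : Distinct3 i j k)

include hd

variable (hv : IsAnchor P i v)

lemma SearchInv.travelled_add_dist_le (hI : SearchInv P i j k v s B x o W) (hs : OnChain P i v s)
    (hsv : ¬ KeptArc P i s v) (hx : KeptArc P i x v) (hc : KeptArc P i c v)
    (hmin : ∀ y, Arc P i y v → coneCoord i c ≤ coneCoord i y) (hcB : |offset j k s c| ≤ B) :
    W + dist x v ≤ 9 * |offset j k s c| + dist c v := by
  have offset_ne {z} (hz : KeptArc P i z v) : offset j k s z ≠ 0 := fun h =>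
    hsv <| hz.toOnChain.eq_of_offset_eq hP hd hs (h.trans (offset_self j k s).symm) ▸ hz
  have behind {z} (hz : KeptArc P i z v) (hneg : offset j k s z < 0) (hzB : -B ≤ offset j k s z) :
      ∃ a, Frontier P i j k v s B x a W ∧ offset k j s a ≤ -offset j k s z := by
    have hswap := offset_swap j k s z
    cases o with
    | none => exact absurd (hI.behind_of_none rfl z hz (by linarith)) (by linarith)
    | some a => exact ⟨a, hI.frontier a rfl, hswap ▸ (hI.frontier a rfl).le_of_keptArc z hz
        (by linarith)⟩
  have hxpos : 0 < offset j k s x := by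
    by_contra! hneg
    obtain ⟨a, ha, hax⟩ := behind hx (hneg.lt_of_ne (offset_ne hx)) hI.neg_budget_le
    linarith [ha.lt]
  rcases (offset_ne hc).lt_or_gt with hneg | hpos
  · rw [abs_of_neg hneg] at hcB ⊢
    obtain ⟨a, ha, hac⟩ := behind hc hneg (by linarith)
    have hxc := hc.toOnChain.dist_le_offset_sub hP hd hx.toOnChain
      ((hc.offset_le_iff hP hd s hx.toOnChain).1 (hneg.trans hxpos).le) s
    rw [dist_comm] at hxc
    linarith [dist_triangle x c v, ha.travelled_le, ha.le_two_mul]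
  · have hle := hI.ahead_le c hc hpos
    obtain rfl : x = c := by
      rcases hx.extreme_or_closest with hext | hclosest
      · refine hx.toOnChain.eq_of_offset_eq hP hd hc.toOnChain (s := s) (hle.antisymm ?_)
        rcases hd.exists_ne.1 hext with hj | hk
        · exact (hc.offset_le_iff hP hd s hx.toOnChain).2 (hj c hc.toArc)
        · have hsx := (hs.offset_le_iff hP hd.swap s hx.toOnChain).2 (hk s (hs.arc hx.mem_head))
          linarith [offset_self k j s, offset_swap j k s x]
      · by_contra hne
        exact hP.coneCoord_ne hx.mem hc.mem hne i ((hclosest c hc.toArc).antisymm (hmin x hx.toArc))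
    rw [abs_of_pos hpos]
    linarith [hI.ahead_travelled_le x hx hpos]

include hv

lemma OnChain.exists_nextVertex (hx : OnChain P i v x) (hm : OnChain P i v m)
    (h : coneCoord j x < coneCoord j m) :
    ∃ y, nextVertex (nbhd P x) j k x = some y ∧ (GTwelve P).Adj x y ∧ OnChain P i v y ∧
      coneCoord j y ≤ coneCoord j m ∧ |offset j k m y| + dist x y ≤ |offset j k m x| := by
  obtain ⟨y, hy⟩ := hx.exists_succ hm h
  have hle := hy.le_of_lt m hm h
  refine ⟨y, hy.nextVertex_eq hP hd hv, hy.adj hP hd hv, hy.right, hle, ?_⟩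
  have hxm := (hx.offset_le_iff hP hd m hm).2 h.le
  have hym := (hy.right.offset_le_iff hP hd m hm).2 hle
  rw [offset_self] at hxm hym
  rw [abs_of_nonpos hxm, abs_of_nonpos hym]
  linarith [hx.dist_le_offset_sub hP hd hy.right hy.lt.le m]

end Search

variable (hv : IsAnchor P i v)
include hv

lemma OnChain.exists_nextToward (hx : OnChain P i v x) (hs : OnChain P i v s) (hne : x ≠ s) :
    ∃ y, nextToward (nbhd P x) i s x = some y ∧ (GTwelve P).Adj x y ∧ OnChain P i v y ∧
      |offset (i + 1) (i + 2) s y| + dist x y ≤ |offset (i + 1) (i + 2) s x| := by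
  have hd := Distinct3.cyclic i
  rw [nextToward]
  split_ifs with h
  · obtain ⟨y, hy, hadj, hyv, -, hdist⟩ := hx.exists_nextVertex hP hd hv hs h
    exact ⟨y, hy, hadj, hyv, hdist⟩
  · have h' := (hs.lt_iff hP hd hx).1
      (lt_of_le_of_ne (le_of_not_gt h) (hP.coneCoord_ne hs.mem hx.mem hne.symm _))
    obtain ⟨y, hy, hadj, hyv, -, hdist⟩ := hx.exists_nextVertex hP hd.swap hv hs h'
    rw [abs_offset_comm, abs_offset_comm (i + 2)] at hdist
    exact ⟨y, hy, hadj, hyv, hdist⟩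

lemma OnChain.arrives_backStep (hx : OnChain P i v x) (hs : OnChain P i v s)
    (hfb : x = s → Arrives P t s fb L)
    (hidle : Arrives P t s (idleStep (nbhd P s) t s (some i)) L) :
    Arrives P t x (backStep fb (nbhd P x) i s x) (|offset (i + 1) (i + 2) s x| + L) := by
  refine induction_on_lt (fun x => |offset (i + 1) (i + 2) s x|)
    (p := fun x => ∀ fb, OnChain P i v x → (x = s → Arrives P t s fb L) →
      Arrives P t x (backStep fb (nbhd P x) i s x) (|offset (i + 1) (i + 2) s x| + L))
    (fun x _ ih fb hx hfb => ?_) hx.mem fb hx hfb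
  rw [backStep]
  split_ifs with hxs
  · subst hxs
    exact (hfb rfl).mono (le_add_of_nonneg_left (abs_nonneg _))
  · obtain ⟨y, hy, hadj, hyv, hdist⟩ := hx.exists_nextToward hP hv hs hxs
    have hlt : |offset (i + 1) (i + 2) s y| < |offset (i + 1) (i + 2) s x| := by
      linarith [dist_pos.2 hadj.ne]
    rw [hy, Option.getD_some]
    refine .move hadj (RouteState.pointsIn_back hs.mem)
      (ih y hyv.mem hlt (idleStep (nbhd P y) t y (some i)) hyv fun h => ?_) (by linarith)
    subst h
    exact hidle

/-- Each step takes at least the minimal distance of two vertices, so that the bound on the distance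
travelled ends the search. -/
lemma SearchInv.exists_terminal (hd : Distinct3 i j k) (hs : OnChain P i v s)
    (hsv : ¬ KeptArc P i s v) (hB : B = 2 * (coneCoord i s - coneCoord i t)) (hB₀ : 0 ≤ B)
    (hI : SearchInv P i j k v s B x o W) :
    ∃ j' k' x' o' W' fb', Distinct3 i j' k' ∧ SearchInv P i j' k' v s B x' o' W' ∧
      (x' = x ∧ fb' = fb ∨ fb' = idleStep (nbhd P x') t x' (some i)) ∧
      (KeptArc P i x' v ∨
        searchStep fb' (nbhd P x') t i j' k' f s o' x' = backStep fb' (nbhd P x') i s x' ∧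
          ∀ z, KeptArc P i z v → B < |offset j' k' s z|) ∧
      ∀ R, Arrives P t x' (searchStep fb' (nbhd P x') t i j' k' f s o' x') (R - W') →
        Arrives P t x (searchStep fb (nbhd P x) t i j k f s o x) (R - W) := by
  obtain ⟨δ, hδ, hdist⟩ := exists_pos_forall_le_dist P
  obtain ⟨n, hn⟩ := exists_nat_gt ((9 * B - W) / δ)
  rw [div_lt_iff₀ hδ] at hn
  induction n generalizing j k x o W fb with
  | zero =>
    rw [Nat.cast_zero, zero_mul] at hn
    linarith [hI.travelled_le, hI.le_budget]
  | succ n ih =>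
    by_cases hend : KeptArc P i x v ∨
        searchStep fb (nbhd P x) t i j k f s o x = backStep fb (nbhd P x) i s x ∧
          ∀ z, KeptArc P i z v → B < |offset j k s z|
    · exact ⟨j, k, x, o, W, fb, hd, hI, .inl ⟨rfl, rfl⟩, hend, fun _ => id⟩
    rw [not_or] at hend
    obtain ⟨j', k', y, o', hd', hadj, hI', hstep⟩ :=
      (hI.step hP hd hv hs hsv hB hB₀ hend.1).resolve_right hend.2
    have hxy := hdist x hI.onChain.mem y hI'.onChain.mem hadj.ne
    rw [Nat.cast_succ, add_one_mul] at hn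
    obtain ⟨j'', k'', x'', o'', W'', fb'', hd'', hI'', hfb'', hend'', harrives⟩ :=
      ih hd' hI' (fb := idleStep (nbhd P y) t y (some i)) (by linarith)
    refine ⟨j'', k'', x'', o'', W'', fb'', hd'', hI'', .inr ?_, hend'', fun R hR => ?_⟩
    · rcases hfb'' with ⟨rfl, rfl⟩ | rfl <;> rfl
    · rw [hstep]
      exact .move hadj (RouteState.pointsIn_search hs.mem fun a ha =>
        (hI'.frontier a ha).onChain.mem) (harrives R hR) (by linarith)

end GeneralPosition

section GeneralPosition

variable {P : Finset Plane} (hP : GeneralPosition P) {i j k : Fin 3} {v s t x : Plane}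
  {L : ℝ} {f : Option (Fin 3)} {fb : Plane × RouteState}

lemma exists_isAnchor_onChain (hs : s ∈ P) : ∃ v, IsAnchor P i v ∧ OnChain P i v s := by
  by_cases h : ∃ w ∈ P, InCone i s w
  · obtain ⟨w, hw, hsw⟩ := h
    obtain ⟨v, hv, -⟩ := exists_arc hs hw hsw
    exact ⟨v, .inl hv.mem_head, hv.toOnChain⟩
  · push Not at h
    obtain ⟨v, hv⟩ := exists_anchor_forall_inCone P i
    exact ⟨v, .inr hv, hs, hv s hs, fun w hw hsw => absurd hsw (h w hw)⟩

include hP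

lemma KeptArc.arrives_searchStep (h : KeptArc P i x v) (htv : coneCoord i t ≤ coneCoord i v)
    (hv : Arrives P t v (idleStep (nbhd P v) t v (newFlag i f s t v)) L) {o : Option Plane} :
    Arrives P t x (searchStep fb (nbhd P x) t i j k f s o x) (dist x v + L) := by
  rw [searchStep_of_keptArc hP h, if_pos htv]
  exact .move (h.adj hP) RouteState.pointsIn_idle hv le_rfl

lemma Arc.arrives_startSearch (hs : Arc P i s v) (htv : coneCoord i t ≤ coneCoord i v)
    (hv : Arrives P t v (idleStep (nbhd P v) t v (newFlag i f s t v)) L) :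
    Arrives P t s (startSearch fb (nbhd P s) t i f s) (19 * dist s v + L) := by
  by_cases hsv : KeptArc P i s v
  · exact (hsv.arrives_searchStep hP htv hv).mono (by linarith [dist_nonneg (x := s) (y := v)])
  have hst := hs.inCone.lt
  have hd := Distinct3.cyclic i
  have hanchor : IsAnchor P i v := .inl hs.mem_head
  have hI := SearchInv.start hP hd hanchor hs.toOnChain hsv
    (B := 2 * (coneCoord i s - coneCoord i t)) (by linarith)
  obtain ⟨j, k, x, o, W, fb', hd', hI', -, hend, harrives⟩ :=
    hI.exists_terminal hP hanchor hd hs.toOnChain hsv rfl (by linarith) (f := f) (fb := fb)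
  obtain ⟨c, hc, hmin⟩ := hs.exists_closest
  obtain ⟨hle, hdetour⟩ := hs.offset_le_and_detour_le hP hd' hc.toArc (hmin s hs)
  rw [startSearch, ← sub_zero (19 * dist s v + L)]
  refine harrives _ ?_
  rcases hend with hxv | ⟨-, hfar⟩
  · refine (hxv.arrives_searchStep hP htv hv).mono ?_
    linarith [hI'.travelled_add_dist_le hP hd' hs.toOnChain hsv hxv hc hmin (by linarith)]
  · linarith [hfar c hc]

lemma arrives_startSearch_of_forall_lt (hs : s ∈ P) (hts : coneCoord i t ≤ coneCoord i s)
    (hfar : ∀ v, Arc P i s v → coneCoord i v < coneCoord i t) (hfb : Arrives P t s fb L)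
    (hidle : Arrives P t s (idleStep (nbhd P s) t s (some i)) L) :
    Arrives P t s (startSearch fb (nbhd P s) t i f s)
      (20 * (coneCoord i s - coneCoord i t) + L) := by
  obtain ⟨v, hv, hsv⟩ := exists_isAnchor_onChain hs (i := i)
  have searchStep_eq {j k x o} {fb} (h : KeptArc P i x v) :
      searchStep fb (nbhd P x) t i j k f s o x = backStep fb (nbhd P x) i s x := by
    rw [searchStep_of_keptArc hP h, if_neg (hfar v (hsv.arc h.mem_head)).not_ge]
  have hd := Distinct3.cyclic i
  by_cases hkept : KeptArc P i s v
  · rw [startSearch, searchStep_eq hkept, backStep, if_pos rfl]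
    exact hfb.mono (by linarith)
  have hI := SearchInv.start hP hd hv hsv hkept
    (B := 2 * (coneCoord i s - coneCoord i t)) (by linarith)
  obtain ⟨j, k, x, o, W, fb', hd', hI', hfb', hend, harrives⟩ :=
    hI.exists_terminal hP hv hd hsv hkept rfl (by linarith) (f := f) (fb := fb)
  rw [startSearch, ← sub_zero (_ + L)]
  refine harrives _ ?_
  have hback : searchStep fb' (nbhd P x) t i j k f s o x = backStep fb' (nbhd P x) i s x :=
    hend.elim searchStep_eq And.left
  rw [hback]
  refine (hI'.onChain.arrives_backStep hP hv hsv (fun hxs => ?_) hidle).mono ?_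
  · subst hxs
    rcases hfb' with ⟨-, rfl⟩ | rfl
    exacts [hfb, hidle]
  · have habs := hd.abs_offset_eq hd' s x
    have hle := abs_le.2 ⟨hI'.neg_budget_le, hI'.le_budget⟩
    linarith [hI'.travelled_le, hI'.le_budget]

end GeneralPosition

/-! ### Direct moves into a negative cone -/

/-- `m` is the vertex by which the routing towards `t` leaves `s` through the negative cone: among
the arcs into `s` from the side of `t` where the `j`-th coordinate is at least that of `t`, the one
from `m` is closest to `t`, and `m` is in the same cone of `t` as `s`. -/
structure IsGateway (P : Finset Plane) (t : Plane) (i j : Fin 3) (s m : Plane) : Prop extends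
    Arc P i m s where
  inClosedCone : InClosedCone i t m
  le_of_arc : ∀ z, Arc P i z s → coneCoord j t ≤ coneCoord j z → coneCoord j m ≤ coneCoord j z

section GeneralPosition

variable {P : Finset Plane} (hP : GeneralPosition P) {i j k : Fin 3} (hd : Distinct3 i j k)
  {s t x m z z₀ z₁ : Plane} {L : ℝ} {f : Option (Fin 3)}
include hP

lemma GeneralPosition.forall_mem_nbhd_inCone_swap_iff {Q : Plane → Prop} :
    (∀ z ∈ nbhd P s, InCone i z s → Q z) ↔ ∀ z, KeptArc P i z s → Q z := by
  simp only [← hP.mem_nbhd_and_inCone_swap_iff, and_imp]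

lemma GeneralPosition.exists_mem_nbhd_inCone_swap_iff {Q : Plane → Prop} :
    (∃ z ∈ nbhd P s, InCone i z s ∧ Q z) ↔ ∃ z, KeptArc P i z s ∧ Q z := by
  simp only [← hP.mem_nbhd_and_inCone_swap_iff, and_assoc]

include hd

lemma exists_isGateway (ht : t ∈ P) (hts : InCone i t s) (hz₀ : Arc P i z₀ s)
    (hz₀t : coneCoord j z₀ < coneCoord j t) (hz₁ : Arc P i z₁ s)
    (hz₁t : coneCoord j t ≤ coneCoord j z₁) : ∃ m, IsGateway P t i j s m := by
  classical
  obtain ⟨m, hm, hmin⟩ := (P.filter fun m => Arc P i m s ∧ coneCoord j t ≤ coneCoord j m)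
    |>.exists_min_image (coneCoord j) ⟨z₁, Finset.mem_filter.2 ⟨hz₁.mem, hz₁, hz₁t⟩⟩
  obtain ⟨-, hms, htm⟩ := Finset.mem_filter.1 hm
  have le_of_arc z (hz : Arc P i z s) (hle : coneCoord j t ≤ coneCoord j z) :
      coneCoord j m ≤ coneCoord j z := hmin z (Finset.mem_filter.2 ⟨hz.mem, hz, hle⟩)
  refine ⟨m, hms, hd.inClosedCone_iff.2 ⟨htm, ?_⟩, le_of_arc⟩
  by_contra! hmt
  obtain ⟨x, hx⟩ := hms.toOnChain.exists_succ hz₀.toOnChain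
    ((hz₀.lt_iff hP hd hms.toOnChain).1 (hz₀t.trans_le htm))
  have hsucc := hx.swap hP hd.swap
  have hxt : coneCoord j x < coneCoord j t := by
    by_contra! hle
    exact (le_of_arc x (hx.right.arc hms.mem_head) hle).not_gt hsucc.lt
  exact (hsucc.gap_empty hP hd ht hxt hmt).not_gt hts.lt

section Walk

variable (hm : IsGateway P t i j s m) (hz : Arc P i z s) (hzt : coneCoord j z < coneCoord j t)
include hm hz hzt

lemma IsGateway.walkStep_eq :
    walkStep (nbhd P m) t j k f m = idleStep (nbhd P m) t m f := by
  have hs : IsAnchor P i s := .inl hm.mem_head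
  have htm : coneCoord j t ≤ coneCoord j m := hm.inClosedCone j hd.ne₁₂.symm
  obtain ⟨y, hy⟩ := hm.toOnChain.exists_succ hz.toOnChain
    ((hz.lt_iff hP hd hm.toOnChain).1 (hzt.trans_le htm))
  have hyt : coneCoord j y < coneCoord j t := by
    by_contra! hle
    exact (hm.le_of_arc y (hy.right.arc hm.mem_head) hle).not_gt (hy.swap hP hd.swap).lt
  rw [walkStep, if_neg htm.not_gt, hy.nextVertex_eq hP hd.swap hs,
    Option.filter_some_neg (by simpa using hyt)]

lemma IsGateway.arrives_walkStep (hx : Arc P i x s)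
    (hidle : Arrives P t m (idleStep (nbhd P m) t m f) L) :
    Arrives P t x (walkStep (nbhd P x) t j k f x) (|offset j k m x| + L) := by
  have hs : IsAnchor P i s := .inl hm.mem_head
  have htm : coneCoord j t ≤ coneCoord j m := hm.inClosedCone j hd.ne₁₂.symm
  refine induction_on_lt (fun x => |offset j k m x|)
    (p := fun x => Arc P i x s →
      Arrives P t x (walkStep (nbhd P x) t j k f x) (|offset j k m x| + L))
    (fun x _ ih hx => ?_) hx.mem hx
  have move_next {y} (hadj : (GTwelve P).Adj x y) (hy : OnChain P i s y)
      (hdist : |offset j k m y| + dist x y ≤ |offset j k m x|) :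
      Arrives P t x (y, .walk j k f) (|offset j k m x| + L) :=
    .move hadj RouteState.pointsIn_walk
      (ih y hy.mem (by linarith [dist_pos.2 hadj.ne]) (hy.arc hm.mem_head)) (by linarith)
  rcases eq_or_ne x m with rfl | hxm
  · rw [hm.walkStep_eq hP hd hz hzt]
    exact hidle.mono (le_add_of_nonneg_left (abs_nonneg _))
  rw [walkStep]
  split_ifs with hxt
  · obtain ⟨y, hnext, hadj, hy, -, hdist⟩ :=
      hx.exists_nextVertex hP hd hs hm.toOnChain (hxt.trans_le htm)
    rw [hnext, Option.getD_some]
    exact move_next hadj hy hdist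
  · have hmx := (hm.le_of_arc x hx (le_of_not_gt hxt)).lt_of_ne
      (hP.coneCoord_ne hm.mem hx.mem hxm.symm j)
    obtain ⟨y, hnext, hadj, hy, hym, hdist⟩ := hx.exists_nextVertex hP hd.swap hs hm.toOnChain
      ((hm.lt_iff hP hd hx.toOnChain).1 hmx)
    have hty := htm.trans ((hm.le_iff hP hd hy).2 hym)
    rw [hnext, Option.filter_some_pos (by simpa using hty)]
    rw [abs_offset_comm, abs_offset_comm k] at hdist
    exact move_next hadj hy hdist

end Walk

omit hd in
lemma descend_eq : descend (nbhd P s) t i j k f s =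
    ((pick fun y => KeptArc P i y s ∧ InClosedCone i t y ∧
        ∀ z, KeptArc P i z s → coneCoord k z ≤ coneCoord k y).map (·, .idle f)).or
      ((pick fun c => KeptArc P i c s ∧
        (∀ z, KeptArc P i z s → coneCoord i c ≤ coneCoord i z) ∧
        (∃ z, KeptArc P i z s ∧ coneCoord j z < coneCoord j t) ∧
        ∃ z, KeptArc P i z s ∧ coneCoord j t ≤ coneCoord j z).map (·, .walk j k f)) := by
  simp only [descend, hP.mem_nbhd_and_inCone_swap_iff, hP.forall_mem_nbhd_inCone_swap_iff,
    hP.exists_mem_nbhd_inCone_swap_iff]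

lemma not_inClosedCone_of_descend_eq_none (h : descend (nbhd P s) t i j k f s = none)
    (hm : Arc P i m s) : ¬ InClosedCone i t m := by
  intro htm
  obtain ⟨hj, hk⟩ := hd.inClosedCone_iff.1 htm
  obtain ⟨w, hw, hwmax⟩ := hm.exists_extreme hd.ne₁₃
  obtain ⟨e, he, hemax⟩ := hm.exists_extreme hd.ne₁₂
  obtain ⟨c, hc, hcmin⟩ := hm.exists_closest
  rw [descend_eq hP, Option.or_eq_none_iff, Option.map_eq_none_iff, Option.map_eq_none_iff,
    pick_eq_none_iff, pick_eq_none_iff] at h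
  obtain ⟨hextreme, hclosest⟩ := h
  have hwt : coneCoord j w < coneCoord j t := by
    by_contra! hle
    exact hextreme w ⟨hw, hd.inClosedCone_iff.2 ⟨hle, hk.trans (hwmax m hm)⟩,
      fun z hz => hwmax z hz.toArc⟩
  exact hclosest c ⟨hc, fun z hz => hcmin z hz.toArc, ⟨w, hw, hwt⟩, e, he, hj.trans (hemax m hm)⟩

lemma KeptArc.isGateway (hm : KeptArc P i m s) (htm : InClosedCone i t m)
    (hmax : ∀ z, KeptArc P i z s → coneCoord k z ≤ coneCoord k m) : IsGateway P t i j s m := by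
  refine ⟨hm.toArc, htm, fun z hz _ => (hm.le_iff hP hd hz.toOnChain).2 ?_⟩
  obtain ⟨w, hw, hwmax⟩ := hz.exists_extreme hd.ne₁₃
  exact (hwmax z hz).trans (hmax w hw)

lemma exists_isGateway_of_descend_eq_some {r : Plane × RouteState} (ht : t ∈ P)
    (hts : InCone i t s) (h : descend (nbhd P s) t i j k f s = some r) :
    ∃ m, IsGateway P t i j s m ∧ ∀ L, Arrives P t m (idleStep (nbhd P m) t m f) L →
      Arrives P t s r (19 * dist s m + L) := by
  rw [descend_eq hP, Option.or_eq_some_iff, Option.map_eq_some_iff, Option.map_eq_some_iff] at h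
  rcases h with ⟨m, hpick, rfl⟩ | ⟨-, c, hpick, rfl⟩
  · obtain ⟨hm, htm, hmax⟩ := of_pick_eq_some hpick
    refine ⟨m, hm.isGateway hP hd htm hmax, fun L hidle => ?_⟩
    exact .move (hm.adj hP).symm RouteState.pointsIn_idle hidle
      (by linarith [dist_nonneg (x := s) (y := m)])
  · obtain ⟨hc, hmin, ⟨z₀, hz₀, hz₀t⟩, z₁, hz₁, hz₁t⟩ := of_pick_eq_some hpick
    obtain ⟨m, hm⟩ := exists_isGateway hP hd ht hts hz₀.toArc hz₀t hz₁.toArc hz₁t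
    refine ⟨m, hm, fun L hidle => .move (hc.adj hP).symm RouteState.pointsIn_walk
      (hm.arrives_walkStep hP hd hz₀.toArc hz₀t hc.toArc hidle) ?_⟩
    have hcm : coneCoord i c ≤ coneCoord i m := by
      obtain ⟨w, hw, hwmin⟩ := hm.toArc.exists_closest
      exact (hmin w hw).trans (hwmin m hm.toArc)
    have hdetour := (hm.offset_le_and_detour_le hP hd hc.toArc hcm).2
    rw [dist_comm, dist_comm m] at hdetour
    linarith [abs_nonneg (offset j k m c)]

end GeneralPosition

/-! ### Arrival -/

/-- The side region of `s` in the cone `C_j` on the way to `t`, that is, the part of that cone up to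
the line through `t` on which the `j`-th coordinate is constant, contains no vertex. -/
def SideEmpty (P : Finset Plane) (t : Plane) (j : Fin 3) (s : Plane) : Prop :=
  ∀ p ∈ P, InCone j s p → coneCoord j p < coneCoord j t

lemma InCone.dist_le {i : Fin 3} {u v : Plane} (h : InCone i u v) :
    dist u v ≤ coneCoord i u - coneCoord i v := by
  have hd := Distinct3.cyclic i
  obtain ⟨hj, hk⟩ := hd.inCone_iff.1 h
  refine (dist_le_add hd.ne₂₃ u v).trans_eq ?_
  rw [abs_of_pos (sub_pos.2 hj), abs_of_pos (sub_pos.2 hk)]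
  linarith [hd.sum_eq_zero u, hd.sum_eq_zero v]

section SideEmpty

variable {P : Finset Plane} {i j k : Fin 3} {s t m y : Plane}

lemma sideEmpty_of_forall_arc (hs : s ∈ P)
    (h : ∀ y, Arc P j s y → coneCoord j y < coneCoord j t) : SideEmpty P t j s := by
  intro p hp hsp
  obtain ⟨y, hy, hle⟩ := exists_arc hs hp hsp
  exact hle.trans_lt (h y hy)

lemma Arc.sideEmpty (hsm : Arc P i s m) (hd : Distinct3 i j k) (hst : InCone i s t) :
    SideEmpty P t k m := by
  intro p hp hmp
  by_contra! htp
  obtain ⟨hi, hj⟩ := hd.rotate.rotate.inCone_iff.1 hmp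
  have hsj := (hd.inCone_iff.1 hsm.inCone).1
  have hsk := (hd.inCone_iff.1 hst).2
  exact (hsm.le_of_inCone p hp (hd.inCone_iff.2 ⟨hsj.trans hj, hsk.trans_le htp⟩)).not_gt hi

variable (hP : GeneralPosition P) (hd : Distinct3 i j k)
include hP hd

lemma SideEmpty.lt_of_lt (hE : SideEmpty P t j s) (hs : s ∈ P) {q : Plane} (hq : q ∈ P)
    (hsq : coneCoord i s < coneCoord i q) (htq : coneCoord j t ≤ coneCoord j q) :
    coneCoord k q < coneCoord k s := by
  have hne : q ≠ s := fun h => hsq.ne (h ▸ rfl)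
  refine (hP.coneCoord_ne hq hs hne k).lt_of_le ?_
  by_contra! hlt
  exact (hE q hq (hd.rotate.inCone_iff.2 ⟨hlt, hsq⟩)).not_ge htq

lemma SideEmpty.of_isGateway (hE : SideEmpty P t j s) (hm : IsGateway P t i j s m) :
    SideEmpty P t j m := by
  intro p hp hmp
  by_contra! htp
  obtain ⟨hk, hi⟩ := hd.rotate.inCone_iff.1 hmp
  have hms := (hd.inCone_iff.1 hm.inCone).1
  obtain ⟨q, hq, hpq⟩ := exists_onChain_above hp (hm.inCone.lt.trans hi) fun q hq hpq hsq => by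
    obtain ⟨hjq, hkq⟩ := hd.inClosedCone_iff.1 hpq
    refine hd.inCone_iff.2
      ⟨lt_of_not_ge fun hle => ?_, hE.lt_of_lt hP hd hm.mem_head hq hsq (htp.trans hjq)⟩
    exact (hm.le_of_inCone q hq (hd.inCone_iff.2 ⟨hms.trans_le hle, hk.trans_le hkq⟩)).not_gt hsq
  obtain ⟨hjq, hkq⟩ := hd.inClosedCone_iff.1 hpq
  have hjqm : coneCoord j q < coneCoord j m := (hq.lt_iff hP hd hm.toOnChain).2 (hk.trans_le hkq)
  exact (hm.le_of_arc q (hq.arc hm.mem_head) (htp.trans hjq)).not_gt hjqm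

lemma exists_side_vertex (ht : t ∈ P) (hE : SideEmpty P t j s) (hs : s ∈ P) (hts : InCone i t s)
    (hno : ∀ m, Arc P i m s → ¬ InClosedCone i t m) :
    ∃ y, Arc P k s y ∧ coneCoord k t ≤ coneCoord k y := by
  by_contra! hlt
  have hF := sideEmpty_of_forall_arc hs hlt
  obtain ⟨q, hq, htq⟩ := exists_onChain_above ht hts.lt fun q hq htq hsq => by
    obtain ⟨hj, hk⟩ := hd.inClosedCone_iff.1 htq
    exact hd.inCone_iff.2 ⟨hF.lt_of_lt hP hd.swap hs hq hsq hk, hE.lt_of_lt hP hd hs hq hsq hj⟩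
  exact hno q (hq.arc hs) htq

lemma SideEmpty.of_side (hE : SideEmpty P t j s) (hsy : Arc P k s y)
    (hty : coneCoord k t ≤ coneCoord k y) (hno : ∀ m, Arc P i m s → ¬ InClosedCone i t m) :
    SideEmpty P t j y := by
  intro p hp hyp
  by_contra! htp
  obtain ⟨hk, hi⟩ := hd.rotate.inCone_iff.1 hyp
  have hsi := (hd.rotate.rotate.inCone_iff.1 hsy.inCone).1
  obtain ⟨q, hq, hpq⟩ := exists_onChain_above hp (hsi.trans hi) fun q hq hpq hsq => by
    obtain ⟨hjq, hkq⟩ := hd.inClosedCone_iff.1 hpq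
    refine hd.inCone_iff.2
      ⟨lt_of_not_ge fun hle => ?_, hE.lt_of_lt hP hd hsy.mem hq hsq (htp.trans hjq)⟩
    have hsq' : InCone k s q := hP.inCone_of_inClosedCone hsy.mem hq (fun h => hsq.ne (h ▸ rfl))
      (hd.rotate.rotate.inClosedCone_iff.2 ⟨hsq.le, hle⟩)
    exact (hsy.le_of_inCone q hq hsq').not_gt (hk.trans_le hkq)
  obtain ⟨hjq, hkq⟩ := hd.inClosedCone_iff.1 hpq
  exact hno q (hq.arc hsy.mem)
    (hd.inClosedCone_iff.2 ⟨htp.trans hjq, (hty.trans hk.le).trans hkq⟩)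

end SideEmpty

section IdleStep

variable {N : Set Plane} {i j k : Fin 3} {s t : Plane} {f : Option (Fin 3)}

lemma third_eq (hd : Distinct3 i j k) : third i j = k := by
  obtain ⟨hij, hik, hjk⟩ := hd
  revert i j k
  decide

lemma pick_inCone (h : InCone i s t) : pick (InCone · s t) = some i :=
  pick_eq_some h fun _ hl => hl.index_unique h

lemma pick_inCone_swap (h : InCone i t s) : pick (InCone · s t) = none :=
  pick_eq_none_iff.2 fun _ => h.not_inCone_swap

lemma idleStep_of_inCone (h : InCone i s t) :
    idleStep N t s f = startSearch (s, .idle none) N t i none s := by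
  simp only [idleStep, pick_inCone h]

lemma idleStep_some (hd : Distinct3 i j k) (h : InCone i t s) :
    idleStep N t s (some j) = flagStep N t i j k s := by
  simp only [idleStep, pick_inCone_swap h, pick_inCone h, third_eq hd]

lemma idleStep_none (h : InCone i t s) :
    ∃ j k, Distinct3 i j k ∧
      coneCoord j s - coneCoord j t ≤ coneCoord k s - coneCoord k t ∧
      idleStep N t s none = unflaggedStep N t i j k s := by
  have hd := Distinct3.cyclic i
  simp only [idleStep, pick_inCone_swap h, pick_inCone h, smallSide]
  split_ifs with hle
  · exact ⟨_, _, hd, hle, by rw [third_eq hd]⟩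
  · exact ⟨_, _, hd.swap, le_of_not_ge hle, by rw [third_eq hd.swap]⟩

lemma newFlag_of_inCone_swap {i' : Fin 3} (h : InCone i' t s) (v : Plane) :
    newFlag i f s t v = f := if_neg h.not_inCone_swap

lemma newFlag_of_inCone {v : Plane} (h : InCone i s t) (hd : Distinct3 i j k)
    (hv : InCone j t v) : newFlag i f s t v = some k := by
  rw [newFlag, if_pos h, pick_inCone hv, Option.map_some, third_eq hd]

end IdleStep

section Arrival

variable {P : Finset Plane} (hP : GeneralPosition P) {i j k : Fin 3} {s t m : Plane}
include hP

lemma GeneralPosition.eq_or_inCone (ht : t ∈ P) (hm : m ∈ P) (h : InClosedCone i t m) :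
    t = m ∨ InCone i t m :=
  or_iff_not_imp_left.2 fun hne => hP.inCone_of_inClosedCone ht hm hne h

lemma arrives_of_sideEmpty (hd : Distinct3 i j k) (ht : t ∈ P) (hs : s ∈ P)
    (hts : InClosedCone i t s) (hE : SideEmpty P t j s) :
    Arrives P t s (idleStep (nbhd P s) t s (some j))
      (19 * ((coneCoord i t - coneCoord i s) + (coneCoord k s - coneCoord k t))) := by
  refine induction_on_lt (fun s => -coneCoord i s)
    (p := fun s => InClosedCone i t s → SideEmpty P t j s →
      Arrives P t s (idleStep (nbhd P s) t s (some j))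
        (19 * ((coneCoord i t - coneCoord i s) + (coneCoord k s - coneCoord k t))))
    (fun s hs ih hts hE => ?_) hs hts hE
  rcases hP.eq_or_inCone ht hs hts with rfl | hts
  · exact .here (by simp)
  rw [idleStep_some hd hts, flagStep]
  cases hdescend : descend (nbhd P s) t i j k (some j) s with
  | none =>
    have hno m (hm : Arc P i m s) : ¬ InClosedCone i t m :=
      not_inClosedCone_of_descend_eq_none hP hd hdescend hm
    obtain ⟨y, hsy, hty⟩ := exists_side_vertex hP hd ht hE hs hts hno
    obtain ⟨hi, hj⟩ := hd.rotate.rotate.inCone_iff.1 hsy.inCone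
    have hty' := hd.inClosedCone_iff.2 ⟨((hd.inCone_iff.1 hts).1.trans hj).le, hty⟩
    have hy := ih y hsy.mem_head (neg_lt_neg hi) hty' (hE.of_side hP hd hsy hty hno)
    rw [← newFlag_of_inCone_swap (i := k) (f := some j) hts y] at hy
    exact (hsy.arrives_startSearch hP hty hy).mono (by linarith [hsy.inCone.dist_le])
  | some r =>
    obtain ⟨m, hm, harrives⟩ := exists_isGateway_of_descend_eq_some hP hd ht hts hdescend
    refine (harrives _ (ih m hm.mem (neg_lt_neg hm.inCone.lt) hm.inClosedCone
      (hE.of_isGateway hP hd hm))).mono ?_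
    have hk := (hd.inCone_iff.1 hm.inCone).2
    linarith [hm.inCone.dist_le, dist_comm s m]

lemma arrives_of_inClosedCone_swap (ht : t ∈ P) (hs : s ∈ P) (hts : InClosedCone i t s)
    (hj : j ≠ i) : Arrives P t s (idleStep (nbhd P s) t s none)
      (19 * (2 * (coneCoord i t - coneCoord i s) + (coneCoord j s - coneCoord j t))) := by
  refine induction_on_lt (fun s => -coneCoord i s)
    (p := fun s => InClosedCone i t s → ∀ j ≠ i, Arrives P t s (idleStep (nbhd P s) t s none)
      (19 * (2 * (coneCoord i t - coneCoord i s) + (coneCoord j s - coneCoord j t))))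
    (fun s hs ih hts => ?_) hs hts j hj
  rcases hP.eq_or_inCone ht hs hts with rfl | hts
  · exact fun j _ => .here (by simp)
  obtain ⟨j, k, hd, hle, hstep⟩ := idleStep_none (N := nbhd P s) hts
  obtain ⟨htj, htk⟩ := hd.inCone_iff.1 hts
  suffices h : Arrives P t s (unflaggedStep (nbhd P s) t i j k s)
      (19 * (2 * (coneCoord i t - coneCoord i s) + (coneCoord j s - coneCoord j t))) by
    rw [hstep, hd.forall_ne]
    exact ⟨h, h.mono (by linarith)⟩
  rw [unflaggedStep]
  cases hdescend : descend (nbhd P s) t i j k none s with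
  | none =>
    by_cases hside : ∃ y, Arc P j s y ∧ coneCoord j t ≤ coneCoord j y
    · obtain ⟨y, hsy, hty⟩ := hside
      obtain ⟨hk, hi⟩ := hd.rotate.inCone_iff.1 hsy.inCone
      have hty' := hd.inClosedCone_iff.2 ⟨hty, (htk.trans hk).le⟩
      have hy := ih y hsy.mem_head (neg_lt_neg hi) hty' j hd.ne₁₂.symm
      rw [← newFlag_of_inCone_swap (i := j) (f := none) hts y] at hy
      exact (hsy.arrives_startSearch hP hty hy).mono (by linarith [hsy.inCone.dist_le])
    · push Not at hside
      have hflag := arrives_of_sideEmpty hP hd ht hs hts.inClosedCone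
        (sideEmpty_of_forall_arc hs hside)
      refine (arrives_startSearch_of_forall_lt hP hs htj.le hside
        (idleStep_some hd hts ▸ hflag) hflag).mono ?_
      linarith [hd.sum_eq_zero s, hd.sum_eq_zero t]
  | some r =>
    obtain ⟨m, hm, harrives⟩ := exists_isGateway_of_descend_eq_some hP hd ht hts hdescend
    refine (harrives _ (ih m hm.mem (neg_lt_neg hm.inCone.lt) hm.inClosedCone j
      hd.ne₁₂.symm)).mono ?_
    have hmj := (hd.inCone_iff.1 hm.inCone).1
    linarith [hm.inCone.dist_le, dist_comm s m, hm.inCone.lt]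

lemma arrives_of_inCone {M : ℝ} (ht : t ∈ P) (hs : s ∈ P) (hst : InCone i s t)
    (hM : ∀ l, l ≠ i → coneCoord l t - coneCoord l s ≤ M) (f : Option (Fin 3)) :
    Arrives P t s (idleStep (nbhd P s) t s f) (19 * ((coneCoord i s - coneCoord i t) + M)) := by
  refine induction_on_lt (coneCoord i)
    (p := fun s => InCone i s t → (∀ l, l ≠ i → coneCoord l t - coneCoord l s ≤ M) → ∀ f,
      Arrives P t s (idleStep (nbhd P s) t s f) (19 * ((coneCoord i s - coneCoord i t) + M)))
    (fun s hs ih hst hM f => ?_) hs hst hM f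
  obtain ⟨v, hsv, htv⟩ := exists_arc hs ht hst
  rw [idleStep_of_inCone hst]
  suffices h : Arrives P t v (idleStep (nbhd P v) t v (newFlag i none s t v))
      (19 * ((coneCoord i v - coneCoord i t) + M)) from
    (hsv.arrives_startSearch hP htv h).mono (by linarith [hsv.inCone.dist_le])
  rcases eq_or_ne v t with rfl | hvt
  · have hd := Distinct3.cyclic i
    have hpos := (hd.inCone_iff.1 hst).1
    exact .here (by linarith [hM _ hd.ne₁₂.symm])
  obtain ⟨l, hvt | htv'⟩ := hP.inCone_cases hsv.mem_head ht hvt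
  · obtain rfl : l = i := by
      by_contra hli
      exact (hvt i (Ne.symm hli)).not_ge htv
    exact ih v hsv.mem_head hsv.inCone.lt hvt
      (fun l hl => (sub_le_sub_left (hsv.inCone l hl).le _).trans (hM l hl)) _
  · have hli : i ≠ l := by
      rintro rfl
      exact htv'.lt.not_ge htv
    obtain ⟨k, hd⟩ := Distinct3.exists_of_ne hli
    rw [newFlag_of_inCone hst hd htv']
    refine (arrives_of_sideEmpty hP hd.rotate ht hsv.mem_head htv'.inClosedCone
      (hsv.sideEmpty hd hst)).mono ?_
    linarith [hM l hli.symm, hsv.inCone l hli.symm]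

end Arrival

instance : Nonempty RouteState := ⟨.idle none⟩

/-- The routing algorithm with transition function `routeStep`. -/
def router : RoutingAlgorithm 1
    (Fintype.card ((Fin 4 × Fin 3 × Fin 3 × Fin 3 × Option (Fin 3)) ⊕ Bool)) :=
  .ofStateMachine (encodeRegisters (RouteState.idle none).registers.1 ∘ RouteState.registers)
    routeStep

lemma deliversWithin_router_of_arrives {P : Finset Plane} {s t : Plane} {L : ℝ}
    (h : Arrives P t s (idleStep (nbhd P s) t s none) L) (hP : 1 < P.card) :
    router.DeliversWithin P (GTwelve P) s t L :=
  RoutingAlgorithm.deliversWithin_ofStateMachine (q₀ := RouteState.idle none)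
    ((encodeRegisters_injective _).comp RouteState.registers_injective)
    (encodeRegisters_none _) (fun _ hq => encodeRegisters_admissible hP hq)
    RouteState.pointsIn_idle h

lemma sub_add_sub_le_two_mul_dist {i j : Fin 3} (h : i ≠ j) (u w : Plane) :
    (coneCoord i u - coneCoord i w) + (coneCoord j w - coneCoord j u) ≤ 2 * dist u w := by
  obtain ⟨k, hd⟩ := Distinct3.exists_of_ne h
  linarith [add_half_le_dist hd.ne₂₃ u w, hd.sum_eq_zero u, hd.sum_eq_zero w]

lemma InCone.exists_two_mul_sub_add_sub_le {i : Fin 3} {u w : Plane} (h : InCone i w u) :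
    ∃ j, j ≠ i ∧ 2 * (coneCoord i w - coneCoord i u) + (coneCoord j u - coneCoord j w) ≤
      5 / √3 * dist w u := by
  obtain ⟨j, k, hd, hle⟩ : ∃ j k, Distinct3 i j k ∧
      coneCoord j u - coneCoord j w ≤ coneCoord k u - coneCoord k w := by
    have hd := Distinct3.cyclic i
    exact (le_total _ _).elim (fun hle => ⟨_, _, hd, hle⟩) fun hle => ⟨_, _, hd.swap, hle⟩
  refine ⟨j, hd.ne₁₂.symm, ?_⟩
  obtain ⟨hj, hk⟩ := hd.inCone_iff.1 h
  have hsum : coneCoord i w - coneCoord i u =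
      (coneCoord j u - coneCoord j w) + (coneCoord k u - coneCoord k w) := by
    linarith [hd.sum_eq_zero u, hd.sum_eq_zero w]
  have hsq := dist_sq_eq hd.ne₂₃ w u
  rw [← sub_pos] at hj hk
  rw [hsum, div_mul_eq_mul_div, le_div_iff₀ (by positivity)]
  generalize coneCoord j u - coneCoord j w = a, coneCoord k u - coneCoord k w = b at *
  refine le_of_sq_le_sq ?_ (by positivity)
  rw [mul_pow, mul_pow, Real.sq_sqrt zero_le_three, hsq]
  have hab : 0 ≤ (b - a) * (2 * a + 13 * b) := mul_nonneg (sub_nonneg.2 hle) (by linarith)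
  linarith

end

theorem mainTheorem8 :
    ∃ (m : ℕ) (A : RoutingAlgorithm 1 m),
      ∀ (P : Finset Plane), GeneralPosition P →
        ∀ u ∈ P, ∀ w ∈ P, (∃ i, w ∈ positiveCone i u) →
          A.DeliversWithin P (GTwelve P) u w (38 * dist u w) ∧
          A.DeliversWithin P (GTwelve P) w u (19 * (5 / Real.sqrt 3) * dist w u) := by
  refine ⟨_, router, fun P hP u hu w hw ⟨i, hwu⟩ => ?_⟩
  rw [hP.mem_positiveCone_iff hu hw] at hwu
  have hcard : 1 < P.card := Finset.one_lt_card.2 ⟨u, hu, w, hw, hwu.ne⟩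
  constructor
  · have hM : ∀ l, l ≠ i → coneCoord l w - coneCoord l u ≤
        2 * dist u w - (coneCoord i u - coneCoord i w) := fun l hl =>
      le_sub_iff_add_le'.2 (sub_add_sub_le_two_mul_dist hl.symm u w)
    have harrives := arrives_of_inCone hP hw hu hwu hM none
    exact deliversWithin_router_of_arrives (harrives.mono (by linarith)) hcard
  · rw [dist_comm w u]
    obtain ⟨j, hj, hle⟩ := hwu.exists_two_mul_sub_add_sub_le
    have harrives := arrives_of_inClosedCone_swap hP hu hw hwu.inClosedCone hj
    exact deliversWithin_router_of_arrives (harrives.mono (by linarith)) hcard
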